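/- Let $\mathfrak h=L^2(\mathbb R^3)$, and let $\mathcal F=\bigoplus_{m\ge 0} L^2_{\mathrm{sym}}((\mathbb R^3)^m)$ be the boson Fock space over $\mathfrak h$. Let $\omega(k)=|k|$, let $d\Gamma(\omega)$ be the second quantization of multiplication by $\omega$, i.e. $(d\Gamma(\omega)\psi)_m(k_1,\dots,k_m)=\sum_i\omega(k_i)\,\psi_m(k_1,\dots,k_m)$ on its maximal domain, and let $\Theta=d\Gamma(\omega)+\mathbf 1$. For $f\in\mathfrak h$ let $a(f)$ and $a^*(f)$ be the usual annihilation and creation operators on their maximal domains, $$(a(f)\psi)_m(k_1,\dots,k_m)=\sqrt{m+1}\int_{\mathbb R^3}\overline{f(x)}\,\psi_{m+1}(x,k_1,\dots,k_m)\,dx,$$ $$(a^*(f)\psi)_0=0,\qquad (a^*(f)\psi)_{m+1}(k_0,\dots,k_m)=\frac1{\sqrt{m+1}}\sum_{i=0}^{m} f(k_i)\,\psi_m(k_0,\dots,\widehat{k_i},\dots,k_m).$$ All products, powers and commutators of these unbounded operators are taken on their natural domains. **Lemma.** Let $n\ge 0$ be an integer, and let $f\in L^2(\mathbb R^3)$ with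 $\omega^{-1/2}f,\ \omega^n f\in L^2(\mathbb R^3)$. Let $a^\#(f)$ denote either $a(f)$ or $a^*(f)$. Then $a^\#(f)\Theta^{-1}$ is defined on all of $\mathcal F$ and bounded, with $$\|a^\#(f)\,\Theta^{-1}\|\ \le\ \big\|(\omega^{-1/2}+1)f\big\|_2 ,$$ and $[\Theta^n,a^\#(f)]\,\Theta^{-n}$ is densely defined and extends to a bounded operator on $\mathcal F$, with $$\big\|[\Theta^n,a^\#(f)]\,\Theta^{-n}\big\|\ \le\ \sum_{k=1}^n\binom nk\,\big\|(\omega^k+1)f\big\|_2 .$$ (For $n=0$ the sum is $0$.) -/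

import Mathlib

open MeasureTheory

noncomputable section

namespace Fock

/-! ### Unbounded operators -/

section Operators

variable {H : Type*} [NormedAddCommGroup H] [NormedSpace ℂ H]

/-- The product `A B` of two unbounded operators on its natural domain
`{x ∈ D(B) | B x ∈ D(A)}`. -/
def mulOp (A B : H →ₗ.[ℂ] H) : H →ₗ.[ℂ] H :=
  A.comp (B.domRestrict ((A.domain.comap B.toFun).map B.domain.subtype)) (by
    rintro ⟨x, hx, hxB⟩
    obtain ⟨y, hy, rfl⟩ := hx
    exact hy)

theorem mem_mulOp_domain (A B : H →ₗ.[ℂ] H) (x : H) :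
    x ∈ (mulOp A B).domain ↔ ∃ hx : x ∈ B.domain, B ⟨x, hx⟩ ∈ A.domain := by
  constructor
  · rintro ⟨⟨y, hy, rfl⟩, -⟩
    exact ⟨y.2, hy⟩
  · rintro ⟨hx, h⟩
    exact ⟨⟨⟨x, hx⟩, h, rfl⟩, hx⟩

theorem mulOp_apply (A B : H →ₗ.[ℂ] H) (x : (mulOp A B).domain) (hx : (x : H) ∈ B.domain)
    (h : B ⟨x, hx⟩ ∈ A.domain) : mulOp A B x = A ⟨B ⟨x, hx⟩, h⟩ := rfl

/-- The identity operator, defined on the whole space. -/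
def idOp : H →ₗ.[ℂ] H := (LinearMap.id : H →ₗ[ℂ] H).toPMap ⊤

/-- Powers `Aⁿ` of an unbounded operator, on their natural domains. -/
def powOp (A : H →ₗ.[ℂ] H) : ℕ → (H →ₗ.[ℂ] H)
  | 0 => idOp
  | n + 1 => mulOp A (powOp A n)

/-- The commutator `[A, B] = A B - B A`, on its natural domain. -/
def commOp (A B : H →ₗ.[ℂ] H) : H →ₗ.[ℂ] H := mulOp A B - mulOp B A

/-- `‖T‖ ≤ C` for a possibly unbounded operator `T`: it is densely defined and extends to a
(necessarily unique) bounded operator on the whole space, of operator norm at most `C`. -/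
def OpNormLE (T : H →ₗ.[ℂ] H) (C : ℝ) : Prop :=
  Dense (T.domain : Set H) ∧ ∃ B : H →L[ℂ] H, (∀ x : T.domain, B x = T x) ∧ ‖B‖ ≤ C

end Operators

/-! ### The boson Fock space over `L²(ℝ³)` -/

/-- Momentum space `ℝ³`. -/
abbrev E3 : Type := EuclideanSpace ℝ (Fin 3)

/-- The one-particle Hilbert space `L²(ℝ³)`. -/
abbrev OneParticle : Type := Lp ℂ 2 (volume : Measure E3)

theorem quasi_perm {n : ℕ} (σ : Equiv.Perm (Fin n)) :
    Measure.QuasiMeasurePreserving (fun k : Fin n → E3 => k ∘ σ) volume volume := by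
  have h := (volume_measurePreserving_piCongrLeft (fun _ : Fin n => E3) σ.symm)
  convert h.quasiMeasurePreserving using 1
  ext k i
  simp [MeasurableEquiv.piCongrLeft, Equiv.piCongrLeft, Equiv.piCongrLeft']

/-- The `n`-particle space `L²_sym((ℝ³)ⁿ)`: square-integrable functions of `n` momenta that are
invariant under permutations of their arguments. For `n = 0` this is `ℂ`. -/
def Sector (n : ℕ) : Submodule ℂ (Lp ℂ 2 (volume : Measure (Fin n → E3))) where
  carrier := {φ | ∀ σ : Equiv.Perm (Fin n), ∀ᵐ k, φ (k ∘ σ) = φ k}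
  zero_mem' := by
    intro σ
    have h := Lp.coeFn_zero ℂ 2 (volume : Measure (Fin n → E3))
    filter_upwards [h, (quasi_perm σ).ae h] with k h1 h2
    rw [h1, h2]; rfl
  add_mem' := by
    intro φ ψ hφ hψ σ
    have h := Lp.coeFn_add φ ψ
    filter_upwards [h, (quasi_perm σ).ae h, hφ σ, hψ σ] with k h1 h2 h3 h4
    rw [h1, h2]; simp [h3, h4]
  smul_mem' := by
    intro c φ hφ σ
    have h := Lp.coeFn_smul c φ
    filter_upwards [h, (quasi_perm σ).ae h, hφ σ] with k h1 h2 h3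
    rw [h1, h2]; simp [h3]

/-- The boson Fock space: the Hilbert space direct sum of the `n`-particle spaces. -/
abbrev FockSpace : Type := lp (fun n : ℕ => Sector n) 2

/-- The `n`-particle component of a Fock space vector, as a function of `n` momenta. -/
def comp (ψ : FockSpace) (n : ℕ) : (Fin n → E3) → ℂ :=
  ((ψ n : Lp ℂ 2 (volume : Measure (Fin n → E3))) : (Fin n → E3) → ℂ)

theorem comp_zero (n : ℕ) : ∀ᵐ k, comp 0 n k = 0 :=
  Lp.coeFn_zero ℂ 2 (volume : Measure (Fin n → E3))

theorem comp_add (ψ φ : FockSpace) (n : ℕ) :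
    ∀ᵐ k, comp (ψ + φ) n k = comp ψ n k + comp φ n k :=
  Lp.coeFn_add (ψ n : Lp ℂ 2 (volume : Measure (Fin n → E3))) (φ n)

theorem comp_smul (c : ℂ) (ψ : FockSpace) (n : ℕ) :
    ∀ᵐ k, comp (c • ψ) n k = c * comp ψ n k :=
  Lp.coeFn_smul c (ψ n : Lp ℂ 2 (volume : Measure (Fin n → E3)))

theorem ext_comp {ψ φ : FockSpace} (h : ∀ n, ∀ᵐ k, comp ψ n k = comp φ n k) : ψ = φ := by
  apply lp.ext
  funext n
  exact Subtype.ext (Lp.ext (h n))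

theorem memLp_comp (ψ : FockSpace) (n : ℕ) : MemLp (comp ψ n) 2 volume :=
  Lp.memLp (ψ n : Lp ℂ 2 (volume : Measure (Fin n → E3)))

/-! ### Second quantization of multiplication operators -/

/-- The graph of `dΓ(w)`: pairs `(ψ, φ)` of Fock space vectors with
`φₙ(k₁,…,kₙ) = (w(k₁) + ⋯ + w(kₙ)) ψₙ(k₁,…,kₙ)` for all `n`. -/
def dGammaGraph (w : E3 → ℝ) : Submodule ℂ (FockSpace × FockSpace) where
  carrier := {p | ∀ n, ∀ᵐ k, comp p.2 n k = ((∑ i, w (k i) : ℝ) : ℂ) * comp p.1 n k}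
  zero_mem' := by
    intro n
    filter_upwards [comp_zero n] with k h
    simp only [Prod.fst_zero, Prod.snd_zero, h, mul_zero]
  add_mem' := by
    intro p q hp hq n
    filter_upwards [comp_add p.1 q.1 n, comp_add p.2 q.2 n, hp n, hq n] with k h1 h2 h3 h4
    rw [Prod.fst_add, Prod.snd_add, h1, h2, h3, h4, mul_add]
  smul_mem' := by
    intro c p hp n
    filter_upwards [comp_smul c p.1 n, comp_smul c p.2 n, hp n] with k h1 h2 h3
    rw [Prod.smul_fst, Prod.smul_snd, h1, h2, h3, mul_left_comm]

/-- The second quantization `dΓ(w)` of multiplication by `w`, on its maximal domain. -/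
def dGamma (w : E3 → ℝ) : FockSpace →ₗ.[ℂ] FockSpace := (dGammaGraph w).toLinearPMap

theorem dGamma_graph (w : E3 → ℝ) : (dGamma w).graph = dGammaGraph w := by
  apply Submodule.toLinearPMap_graph_eq
  rintro ⟨ψ, φ⟩ h (rfl : ψ = 0)
  refine ext_comp fun n => ?_
  filter_upwards [h n, comp_zero n] with k h1 h2
  rw [h1, h2, mul_zero]

/-! ### Creation and annihilation operators -/

theorem quasi_removeNth {n : ℕ} (i : Fin (n + 1)) :
    Measure.QuasiMeasurePreserving (fun k : Fin (n + 1) → E3 => i.removeNth k) volume volume :=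
  Measure.quasiMeasurePreserving_snd.comp
    (volume_preserving_piFinSuccAbove (fun _ : Fin (n + 1) => E3) i).quasiMeasurePreserving

/-- The graph of the creation operator `a*(f)`: pairs `(ψ, φ)` with `φ₀ = 0` and
`φₙ₊₁(k₀,…,kₙ) = (n+1)^{-1/2} ∑ᵢ f(kᵢ) ψₙ(k₀,…,kᵢ omitted,…,kₙ)`. -/
def creationGraph (f : OneParticle) : Submodule ℂ (FockSpace × FockSpace) where
  carrier := {p | (∀ᵐ k, comp p.2 0 k = 0) ∧
    ∀ n : ℕ, ∀ᵐ k : Fin (n + 1) → E3, comp p.2 (n + 1) k =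
      ((√(n + 1 : ℝ))⁻¹ : ℝ) * ∑ i, f (k i) * comp p.1 n (i.removeNth k)}
  zero_mem' := by
    refine ⟨comp_zero 0, fun n => ?_⟩
    have h : ∀ᵐ k : Fin (n + 1) → E3, ∀ i : Fin (n + 1), comp 0 n (i.removeNth k) = 0 :=
      ae_all_iff.2 fun i => (quasi_removeNth i).ae (comp_zero n)
    filter_upwards [h, comp_zero (n + 1)] with k h1 h2
    simp [h1, h2]
  add_mem' := by
    rintro p q ⟨hp0, hp⟩ ⟨hq0, hq⟩
    refine ⟨?_, fun n => ?_⟩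
    · filter_upwards [comp_add p.2 q.2 0, hp0, hq0] with k h1 h2 h3
      rw [Prod.snd_add, h1, h2, h3, add_zero]
    have h : ∀ᵐ k : Fin (n + 1) → E3, ∀ i : Fin (n + 1), comp (p.1 + q.1) n (i.removeNth k) =
        comp p.1 n (i.removeNth k) + comp q.1 n (i.removeNth k) :=
      ae_all_iff.2 fun i => (quasi_removeNth i).ae (comp_add p.1 q.1 n)
    filter_upwards [h, comp_add p.2 q.2 (n + 1), hp n, hq n] with k h1 h2 h3 h4
    rw [Prod.snd_add, Prod.fst_add, h2, h3, h4, ← mul_add, ← Finset.sum_add_distrib]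
    simp only [h1, mul_add]
  smul_mem' := by
    rintro c p ⟨hp0, hp⟩
    refine ⟨?_, fun n => ?_⟩
    · filter_upwards [comp_smul c p.2 0, hp0] with k h1 h2
      rw [Prod.smul_snd, h1, h2, mul_zero]
    have h : ∀ᵐ k : Fin (n + 1) → E3, ∀ i : Fin (n + 1), comp (c • p.1) n (i.removeNth k) =
        c * comp p.1 n (i.removeNth k) :=
      ae_all_iff.2 fun i => (quasi_removeNth i).ae (comp_smul c p.1 n)
    filter_upwards [h, comp_smul c p.2 (n + 1), hp n] with k h1 h2 h3
    rw [Prod.smul_snd, Prod.smul_fst, h2, h3, mul_left_comm, Finset.mul_sum]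
    simp only [h1, mul_left_comm]

/-- The creation operator `a*(f)`, on its maximal domain. -/
def creation (f : OneParticle) : FockSpace →ₗ.[ℂ] FockSpace := (creationGraph f).toLinearPMap

theorem creation_graph (f : OneParticle) : (creation f).graph = creationGraph f := by
  apply Submodule.toLinearPMap_graph_eq
  rintro ⟨ψ, φ⟩ ⟨h0, h⟩ (rfl : ψ = 0)
  refine ext_comp fun n => ?_
  cases n with
  | zero =>
    filter_upwards [h0, comp_zero 0] with k h1 h2
    rw [h1, h2]
  | succ n =>
    have h' : ∀ᵐ k : Fin (n + 1) → E3, ∀ i : Fin (n + 1), comp 0 n (i.removeNth k) = 0 :=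
      ae_all_iff.2 fun i => (quasi_removeNth i).ae (comp_zero n)
    filter_upwards [h n, h', comp_zero (n + 1)] with k h1 h2 h3
    rw [h1, h3]; simp [h2]

theorem measurePreserving_cons (n : ℕ) :
    MeasurePreserving (fun p : E3 × (Fin n → E3) => (Fin.cons p.1 p.2 : Fin (n + 1) → E3))
      (volume.prod volume) volume := by
  have h := (volume_preserving_piFinSuccAbove (fun _ : Fin (n + 1) => E3) 0).symm
  have he : (fun p : E3 × (Fin n → E3) => (Fin.cons p.1 p.2 : Fin (n + 1) → E3)) =
      (MeasurableEquiv.piFinSuccAbove (fun _ : Fin (n + 1) => E3) 0).symm := by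
    funext p
    exact (Fin.insertNth_zero (α := fun _ => E3) p.1 p.2).symm
  rw [he]
  exact h

/-- Statements true almost everywhere hold on almost every slice `x ↦ (x, k₁, …, kₙ)`. -/
theorem ae_slice {n : ℕ} {P : (Fin (n + 1) → E3) → Prop} (h : ∀ᵐ k, P k) :
    ∀ᵐ k : Fin n → E3, ∀ᵐ x : E3, P (Fin.cons x k) :=
  Measure.ae_ae_of_ae_prod (p := fun q : (Fin n → E3) × E3 => P (Fin.cons q.2 q.1))
    (((measurePreserving_cons n).comp Measure.measurePreserving_swap).quasiMeasurePreserving.ae h)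

theorem integrable_slice (f : OneParticle) (ψ : FockSpace) (n : ℕ) :
    ∀ᵐ k : Fin n → E3,
      Integrable (fun x : E3 => starRingEnd ℂ (f x) * comp ψ (n + 1) (Fin.cons x k)) := by
  have hm : MemLp (fun q : (Fin n → E3) × E3 => comp ψ (n + 1) (Fin.cons q.2 q.1)) 2
      (volume.prod volume) :=
    (memLp_comp ψ (n + 1)).comp_measurePreserving
      ((measurePreserving_cons n).comp Measure.measurePreserving_swap)
  have h1 := (memLp_two_iff_integrable_sq_norm hm.1).1 hm
  filter_upwards [hm.1.prodMk_left, h1.prod_right_ae] with k h2 h3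
  have h4 : MemLp (fun x : E3 => comp ψ (n + 1) (Fin.cons x k)) 2 volume :=
    (memLp_two_iff_integrable_sq_norm h2).2 h3
  exact (Lp.memLp f).star.integrable_mul h4

/-- The graph of the annihilation operator `a(f)`: pairs `(ψ, φ)` with
`φₙ(k₁,…,kₙ) = (n+1)^{1/2} ∫ conj(f(x)) ψₙ₊₁(x,k₁,…,kₙ) dx`. -/
def annihilationGraph (f : OneParticle) : Submodule ℂ (FockSpace × FockSpace) where
  carrier := {p | ∀ n : ℕ, ∀ᵐ k : Fin n → E3, comp p.2 n k =
      (√(n + 1 : ℝ) : ℝ) * ∫ x : E3, starRingEnd ℂ (f x) * comp p.1 (n + 1) (Fin.cons x k)}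
  zero_mem' := by
    intro n
    filter_upwards [comp_zero n, ae_slice (comp_zero (n + 1))] with k h1 h2
    have : ∫ x : E3, starRingEnd ℂ (f x) * comp 0 (n + 1) (Fin.cons x k) = 0 := by
      apply integral_eq_zero_of_ae
      filter_upwards [h2] with x hx
      simp [hx]
    simp only [Prod.fst_zero, Prod.snd_zero, h1, this, mul_zero]
  add_mem' := by
    intro p q hp hq n
    filter_upwards [comp_add p.2 q.2 n, ae_slice (comp_add p.1 q.1 (n + 1)), hp n, hq n,
      integrable_slice f p.1 n, integrable_slice f q.1 n] with k h1 h2 h3 h4 h5 h6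
    rw [Prod.snd_add, Prod.fst_add, h1, h3, h4, ← mul_add, ← integral_add h5 h6]
    congr 1
    apply integral_congr_ae
    filter_upwards [h2] with x hx
    rw [hx, mul_add]
  smul_mem' := by
    intro c p hp n
    filter_upwards [comp_smul c p.2 n, ae_slice (comp_smul c p.1 (n + 1)), hp n]
      with k h1 h2 h3
    rw [Prod.smul_snd, Prod.smul_fst, h1, h3, mul_left_comm, ← integral_const_mul]
    congr 1
    apply integral_congr_ae
    filter_upwards [h2] with x hx
    rw [hx, mul_left_comm]

/-- The annihilation operator `a(f)`, on its maximal domain. -/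
def annihilation (f : OneParticle) : FockSpace →ₗ.[ℂ] FockSpace :=
  (annihilationGraph f).toLinearPMap

theorem annihilation_graph (f : OneParticle) : (annihilation f).graph = annihilationGraph f := by
  apply Submodule.toLinearPMap_graph_eq
  rintro ⟨ψ, φ⟩ h (rfl : ψ = 0)
  refine ext_comp fun n => ?_
  filter_upwards [h n, comp_zero n, ae_slice (comp_zero (n + 1))] with k h1 h2 h3
  have : ∫ x : E3, starRingEnd ℂ (f x) * comp 0 (n + 1) (Fin.cons x k) = 0 := by
    apply integral_eq_zero_of_ae
    filter_upwards [h3] with x hx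
    simp [hx]
  rw [h1, h2, this, mul_zero]

/-! ### The field energy -/

/-- The photon dispersion `ω(k) = |k|`. -/
def omega (k : E3) : ℝ := ‖k‖

/-- `Θ = dΓ(ω) + 1`. -/
def Theta : FockSpace →ₗ.[ℂ] FockSpace := dGamma omega + idOp

theorem Theta_ker (x : Theta.domain) (h : Theta x = 0) : (x : FockSpace) = 0 := by
  have hx : (x : FockSpace) ∈ (dGamma omega).domain := x.2.1
  have hg : ((x : FockSpace), dGamma omega ⟨x, hx⟩) ∈ dGammaGraph omega := by
    rw [← dGamma_graph]
    exact (dGamma omega).mem_graph ⟨x, hx⟩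
  have h' : dGamma omega ⟨x, hx⟩ + (x : FockSpace) = 0 := h
  refine ext_comp fun n => ?_
  filter_upwards [hg n, comp_add (dGamma omega ⟨x, hx⟩) (x : FockSpace) n, comp_zero n]
    with k h1 h2 h3
  rw [h', h3, h1] at h2
  have hs : 0 ≤ ∑ i, omega (k i) := Finset.sum_nonneg fun i _ => norm_nonneg (k i)
  have hne : ((∑ i, omega (k i) : ℝ) : ℂ) + 1 ≠ 0 := by
    exact_mod_cast (by positivity : (∑ i, omega (k i)) + 1 ≠ 0)
  have h4 : (((∑ i, omega (k i) : ℝ) : ℂ) + 1) * comp (x : FockSpace) n k = 0 := by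
    rw [add_mul, one_mul]; exact h2.symm
  rw [h3]
  exact (mul_eq_zero.1 h4).resolve_left hne

/-- `Θⁿ` is injective, so that its inverse is the inverse operator with domain the range. -/
theorem powOp_Theta_ker (n : ℕ) (x : (powOp Theta n).domain) (h : powOp Theta n x = 0) :
    (x : FockSpace) = 0 := by
  induction n with
  | zero => exact h
  | succ n ih =>
    obtain ⟨hx, hT⟩ := (mem_mulOp_domain Theta (powOp Theta n) x).1 x.2
    exact ih ⟨x, hx⟩ (Theta_ker ⟨_, hT⟩ h)

/-- The `L²(ℝ³)` norm of a function (which is to be square-integrable). -/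
def normL2 (g : E3 → ℂ) : ℝ := (eLpNorm g 2 volume).toReal

end Fock

end

/-!
Write `R = Θ⁻¹`, which acts on the `m`-particle space as multiplication by the reciprocal of
`θ(k) = 1 + ω(k₁) + ⋯ + ω(kₘ)`, and let `a#` be `a` or `a*`. Everything rests on one estimate: if
`|g| ≤ |G|` and `|g| ≤ ω^{1/2} |G|` almost everywhere, then `‖a#(g) ψ‖² ≤ ‖G‖² ⟨ψ, Θ ψ⟩`
(`lintegral_annihilation_le`, `lintegral_creation_le`). For `a(g)` this is the Cauchy-Schwarz
inequality in the integrated variable together with the symmetry of `ψ`. For `a*(g)` it holds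
already under the integral sign: in the square of `∑ᵢ g(kᵢ) ψ(k without kᵢ)` a cross term is split by
the arithmetic-geometric mean inequality after trading `|g(kᵢ) g(kⱼ)|` for
`ω(kᵢ)^{1/2} ω(kⱼ)^{1/2} |G(kᵢ) G(kⱼ)|` (`sq_sum_mul_le`). Since `⟨R φ, Θ R φ⟩ ≤ ‖φ‖²`, the operator
`a#(g) R` is everywhere defined with norm at most `‖G‖`. The first bound is the case `g = f`,
`G = (ω^{-1/2} + 1) f`.

For the commutator, `θ` changes by `± ω` of the momentum that is created or annihilated, so that
the binomial theorem gives
`[Θⁿ, a*(f)] = ∑ⱼ C(n, j) a*(ωʲ f) Θⁿ⁻ʲ` and `[Θⁿ, a(f)] = ∑ⱼ (-1)ʲ C(n, j) a(ωʲ f) Θⁿ⁻ʲ`, with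
`1 ≤ j ≤ n` (`powOp_Theta_creation`, `powOp_Theta_annihilation`). Hence `[Θⁿ, a#(f)] Θ⁻ⁿ` is a
restriction of `∑ⱼ (±1)ʲ C(n, j) (a#(ωʲ f) R) Rʲ⁻¹`, and the `j`-th term is bounded with
`g = ωʲ f`, `G = (ωʲ + 1) f` and `‖R‖ ≤ 1`. Its domain contains the range of `R`, which is dense
because `R` multiplies by a positive function (`opNormLE_commOp_mulOp_inverse`,
`denseRange_resolvent`).

Unbounded operators are handled through their graphs throughout, so that domain questions become
the existence of a vector with prescribed components (`exists_comp_eq`).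
-/

namespace Fock

/-! ### Graphs of unbounded operators -/

section Graphs

variable {H : Type*} [NormedAddCommGroup H] [NormedSpace ℂ H]

theorem mem_graph_mulOp {A B : H →ₗ.[ℂ] H} {x z : H} :
    (x, z) ∈ (mulOp A B).graph ↔ ∃ y, (x, y) ∈ B.graph ∧ (y, z) ∈ A.graph := by
  constructor
  · intro h
    obtain ⟨w, rfl, rfl⟩ := (LinearPMap.mem_graph_iff _).1 h
    obtain ⟨hx, hB⟩ := (mem_mulOp_domain A B w).1 w.2
    refine ⟨_, B.mem_graph ⟨w, hx⟩, ?_⟩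
    rw [mulOp_apply A B w hx hB]
    exact A.mem_graph ⟨_, hB⟩
  · rintro ⟨y, hB, hA⟩
    obtain ⟨x', rfl, rfl⟩ := (LinearPMap.mem_graph_iff _).1 hB
    obtain ⟨y', h1, rfl⟩ := (LinearPMap.mem_graph_iff _).1 hA
    have hmem : B ⟨x', x'.2⟩ ∈ A.domain := by
      have := y'.2
      rw [h1] at this
      exact this
    have hx : (x' : H) ∈ (mulOp A B).domain := (mem_mulOp_domain A B _).2 ⟨x'.2, hmem⟩
    refine (LinearPMap.mem_graph_iff _).2 ⟨⟨x', hx⟩, rfl, ?_⟩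
    rw [mulOp_apply A B ⟨x', hx⟩ x'.2 hmem]
    congr 1
    exact Subtype.ext h1.symm

theorem mem_graph_sub {A B : H →ₗ.[ℂ] H} {x z : H} :
    (x, z) ∈ (A - B).graph ↔ ∃ y₁ y₂, (x, y₁) ∈ A.graph ∧ (x, y₂) ∈ B.graph ∧ z = y₁ - y₂ := by
  constructor
  · intro h
    obtain ⟨w, rfl, rfl⟩ := (LinearPMap.mem_graph_iff _).1 h
    exact ⟨_, _, A.mem_graph ⟨w, w.2.1⟩, B.mem_graph ⟨w, w.2.2⟩, rfl⟩
  · rintro ⟨y₁, y₂, h1, h2, rfl⟩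
    obtain ⟨x₁, rfl, rfl⟩ := (LinearPMap.mem_graph_iff _).1 h1
    obtain ⟨x₂, h3, rfl⟩ := (LinearPMap.mem_graph_iff _).1 h2
    simp only at h3
    have hm : (x₁ : H) ∈ B.domain := h3 ▸ x₂.2
    obtain rfl : x₂ = ⟨x₁, hm⟩ := Subtype.ext h3
    exact (LinearPMap.mem_graph_iff _).2 ⟨⟨x₁, x₁.2, hm⟩, rfl, rfl⟩

theorem mem_graph_commOp {A B : H →ₗ.[ℂ] H} {x z : H} :
    (x, z) ∈ (commOp A B).graph ↔
      ∃ y₁ y₂, (x, y₁) ∈ (mulOp A B).graph ∧ (x, y₂) ∈ (mulOp B A).graph ∧ z = y₁ - y₂ :=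
  mem_graph_sub

theorem mem_graph_idOp {x z : H} : (x, z) ∈ (idOp : H →ₗ.[ℂ] H).graph ↔ z = x := by
  constructor
  · intro h
    obtain ⟨w, rfl, rfl⟩ := (LinearPMap.mem_graph_iff _).1 h
    rfl
  · rintro rfl
    exact (LinearPMap.mem_graph_iff _).2 ⟨⟨z, trivial⟩, rfl, rfl⟩

theorem mem_graph_add_idOp {A : H →ₗ.[ℂ] H} {x z : H} :
    (x, z) ∈ (A + idOp).graph ↔ (x, z - x) ∈ A.graph := by
  constructor
  · intro h
    obtain ⟨w, rfl, rfl⟩ := (LinearPMap.mem_graph_iff _).1 h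
    have : (A + idOp : H →ₗ.[ℂ] H) w - w = A ⟨w, w.2.1⟩ := add_sub_cancel_right _ _
    simp only [this]
    exact A.mem_graph ⟨w, w.2.1⟩
  · intro h
    obtain ⟨w, rfl, h2⟩ := (LinearPMap.mem_graph_iff _).1 h
    refine (LinearPMap.mem_graph_iff _).2 ⟨⟨w, w.2, trivial⟩, rfl, ?_⟩
    exact (sub_eq_iff_eq_add.1 h2.symm).symm

theorem mem_graph_inverse {A : H →ₗ.[ℂ] H} (hA : ∀ x : A.domain, A x = 0 → (x : H) = 0)
    {x z : H} : (x, z) ∈ A.inverse.graph ↔ (z, x) ∈ A.graph := by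
  have hker : A.toFun.ker = ⊥ := by
    rw [LinearMap.ker_eq_bot']
    exact fun x hx => Subtype.ext (hA x hx)
  rw [LinearPMap.inverse_graph hker]
  simp

/-- The graph criterion for `‖T‖ ≤ C`: a densely defined operator whose graph lies in that of an
everywhere defined operator `B` with `‖B‖ ≤ C`. -/
theorem OpNormLE.of_graph {T : H →ₗ.[ℂ] H} {C : ℝ} (B : H →L[ℂ] H) (hB : ‖B‖ ≤ C)
    (hd : Dense (T.domain : Set H)) (h : ∀ x z, (x, z) ∈ T.graph → B x = z) : OpNormLE T C :=
  ⟨hd, B, fun x => h x _ (T.mem_graph x), hB⟩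

/-- An operator that is everywhere defined and bounded, in terms of its graph. -/
theorem exists_continuousLinearMap_of_graph (T : H →ₗ.[ℂ] H) {C : ℝ} (hC : 0 ≤ C)
    (h : ∀ x, ∃ z, (x, z) ∈ T.graph ∧ ‖z‖ ≤ C * ‖x‖) :
    ∃ B : H →L[ℂ] H, ‖B‖ ≤ C ∧ ∀ x, (x, B x) ∈ T.graph := by
  have hd : ∀ x, x ∈ T.domain := fun x =>
    let ⟨z, hz, _⟩ := h x
    LinearPMap.mem_domain_iff.2 ⟨z, hz⟩
  let L : H →ₗ[ℂ] H := T.toFun.comp (LinearMap.id.codRestrict T.domain hd)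
  have hL : ∀ x, (x, L x) ∈ T.graph := fun x => T.mem_graph ⟨x, hd x⟩
  refine ⟨L.mkContinuous C fun x => ?_, LinearMap.mkContinuous_norm_le _ hC _, hL⟩
  obtain ⟨z, hz, hzC⟩ := h x
  rwa [T.mem_graph_snd_inj (hL x) hz rfl]

/-- Boundedness of `[D, A] D⁻¹` for an injective `D`. If `R` is a bounded operator with dense range
such that `A R` is everywhere defined and `R` has values in the range of `D`, and if `B` is a bounded
operator with `D A = B D + A D` in the sense of graphs, then `[D, A] D⁻¹` is densely defined
and extends to `B`. -/
theorem opNormLE_commOp_mulOp_inverse {D A : H →ₗ.[ℂ] H}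
    (hD : ∀ x : D.domain, D x = 0 → (x : H) = 0) {R : H →L[ℂ] H} (hR : DenseRange R)
    (hAR : ∀ x, R x ∈ A.domain)
    (hDR : ∀ x, ∃ y, (R y, R x) ∈ D.graph)
    {B : H →L[ℂ] H} {C : ℝ} (hB : ‖B‖ ≤ C)
    (h : ∀ x Dx y z, (x, Dx) ∈ D.graph → (x, y) ∈ A.graph → (Dx, z) ∈ A.graph →
      (y, B Dx + z) ∈ D.graph) :
    OpNormLE (mulOp (commOp D A) D.inverse) C := by
  refine OpNormLE.of_graph B hB (hR.mono ?_) ?_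
  · rintro _ ⟨x, rfl⟩
    obtain ⟨y, hy⟩ := hDR x
    obtain ⟨z₁, hz₁⟩ := LinearPMap.mem_domain_iff.1 (hAR y)
    obtain ⟨z₂, hz₂⟩ := LinearPMap.mem_domain_iff.1 (hAR x)
    exact LinearPMap.mem_domain_iff.2 ⟨_, mem_graph_mulOp.2 ⟨_, (mem_graph_inverse hD).2 hy,
      mem_graph_commOp.2 ⟨_, _, mem_graph_mulOp.2 ⟨_, hz₁, h _ _ _ _ hy hz₁ hz₂⟩,
        mem_graph_mulOp.2 ⟨_, hy, hz₂⟩, rfl⟩⟩⟩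
  · intro x z hxz
    obtain ⟨u, hu, hc⟩ := mem_graph_mulOp.1 hxz
    rw [mem_graph_inverse hD] at hu
    obtain ⟨y₁, y₂, h1, h2, rfl⟩ := mem_graph_commOp.1 hc
    obtain ⟨v, hv, hv1⟩ := mem_graph_mulOp.1 h1
    obtain ⟨w, hw, hw2⟩ := mem_graph_mulOp.1 h2
    obtain rfl : w = x := D.mem_graph_snd_inj hw hu rfl
    rw [D.mem_graph_snd_inj hv1 (h _ _ _ _ hu hv hw2) rfl, add_sub_cancel_right]

theorem norm_sum_smul_mul_pow_le {s : Finset ℕ} {c : ℕ → ℂ} {B : ℕ → H →L[ℂ] H}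
    {R : H →L[ℂ] H} (hR : ‖R‖ ≤ 1) {C D : ℕ → ℝ} (hc : ∀ j ∈ s, ‖c j‖ ≤ C j)
    (hB : ∀ j ∈ s, ‖B j‖ ≤ D j) :
    ‖∑ j ∈ s, c j • (B j * R ^ (j - 1))‖ ≤ ∑ j ∈ s, C j * D j := by
  have hpow (j : ℕ) : ‖R ^ j‖ ≤ 1 :=
    ContinuousLinearMap.opNorm_le_bound _ zero_le_one fun x => by
      induction j with
      | zero => simp
      | succ j ih =>
        rw [pow_succ', mul_apply_eq_comp]
        exact (R.le_opNorm _).trans ((mul_le_of_le_one_left (norm_nonneg _) hR).trans ih)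
  refine (norm_sum_le _ _).trans (Finset.sum_le_sum fun j hj => ?_)
  rw [norm_smul]
  refine mul_le_mul (hc j hj) ?_ (norm_nonneg _) ((norm_nonneg _).trans (hc j hj))
  exact (norm_mul_le _ _).trans
    ((mul_le_of_le_one_right (norm_nonneg _) (hpow _)).trans (hB j hj))

end Graphs

/-! ### Fock space vectors and the inverse of `Θ` -/

theorem enorm_sq_eq_tsum (ψ : FockSpace) :
    ‖ψ‖ₑ ^ 2 = ∑' m, ∫⁻ k, ‖comp ψ m k‖ₑ ^ 2 := by
  have h2 : 0 < (2 : ENNReal).toReal := by simp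
  have h := lp.norm_rpow_eq_tsum h2 ψ
  have hs := (lp.hasSum_norm h2 ψ).summable
  simp only [ENNReal.toReal_ofNat, Real.rpow_ofNat] at h hs
  rw [← ofReal_norm, ← ENNReal.ofReal_pow (norm_nonneg _), h,
    ENNReal.ofReal_tsum_of_nonneg (fun _ => by positivity) hs]
  refine tsum_congr fun m => ?_
  rw [ENNReal.ofReal_pow (norm_nonneg _), ofReal_norm]
  have h3 := eLpNorm_nnreal_pow_eq_lintegral (f := comp ψ m) (p := 2) (μ := volume) (by simp)
  simp only [NNReal.coe_ofNat, ENNReal.rpow_ofNat, ENNReal.coe_ofNat] at h3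
  rw [← h3, comp, ← Lp.enorm_def]
  rfl

/-- A sequence of permutation-invariant measurable functions with summable squared `L²` norms
is the sequence of components of a Fock space vector. -/
theorem exists_comp_eq (F : ∀ m, (Fin m → E3) → ℂ)
    (hm : ∀ m, AEStronglyMeasurable (F m) volume)
    (hsym : ∀ m, ∀ σ : Equiv.Perm (Fin m), ∀ᵐ k, F m (k ∘ σ) = F m k)
    (hF : ∑' m, ∫⁻ k, ‖F m k‖ₑ ^ 2 ≠ ⊤) :
    ∃ ψ : FockSpace, ∀ m, ∀ᵐ k, comp ψ m k = F m k := by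
  have hn (m : ℕ) : eLpNorm (F m) 2 volume ^ 2 = ∫⁻ k, ‖F m k‖ₑ ^ 2 := by
    have h3 := eLpNorm_nnreal_pow_eq_lintegral (f := F m) (p := 2) (μ := volume) (by simp)
    simpa using h3
  have hL (m : ℕ) : MemLp (F m) 2 volume := by
    refine ⟨hm m, lt_top_iff_ne_top.2 fun h => ENNReal.ne_top_of_tsum_ne_top hF m ?_⟩
    rw [← hn, h]
    simp
  have hS (m : ℕ) : (hL m).toLp ∈ Sector m := by
    intro σ
    filter_upwards [hsym m σ, (hL m).coeFn_toLp, (quasi_perm σ).ae (hL m).coeFn_toLp]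
      with k h1 h2 h3
    rw [h2, h3, h1]
  have hmem : Memℓp (fun m => (⟨(hL m).toLp, hS m⟩ : Sector m)) 2 := by
    apply memℓp_gen
    have h4 := ENNReal.summable_toReal hF
    refine h4.congr fun m => ?_
    simp only [ENNReal.toReal_ofNat, Real.rpow_ofNat]
    rw [← hn, ENNReal.toReal_pow, Submodule.coe_norm, Lp.norm_toLp]
  exact ⟨⟨_, hmem⟩, fun m => (hL m).coeFn_toLp⟩

theorem comp_sub (ψ φ : FockSpace) (n : ℕ) :
    ∀ᵐ k, comp (ψ - φ) n k = comp ψ n k - comp φ n k :=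
  Lp.coeFn_sub (ψ n : Lp ℂ 2 (volume : Measure (Fin n → E3))) (φ n)

theorem comp_sum {ι : Type*} (s : Finset ι) (ψ : ι → FockSpace) (n : ℕ) :
    ∀ᵐ k, comp (∑ i ∈ s, ψ i) n k = ∑ i ∈ s, comp (ψ i) n k := by
  classical
  induction s using Finset.induction_on with
  | empty => simpa using comp_zero n
  | insert i s hi ih =>
    rw [Finset.sum_insert hi]
    filter_upwards [ih, comp_add (ψ i) (∑ i ∈ s, ψ i) n] with k h1 h2
    rw [h2, h1, Finset.sum_insert hi]

theorem comp_perm (ψ : FockSpace) (n : ℕ) (σ : Equiv.Perm (Fin n)) :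
    ∀ᵐ k, comp ψ n (k ∘ σ) = comp ψ n k :=
  (ψ n).2 σ

theorem measurePreserving_perm {n : ℕ} (σ : Equiv.Perm (Fin n)) :
    MeasurePreserving (fun k : Fin n → E3 => k ∘ σ) volume volume := by
  have h := volume_measurePreserving_piCongrLeft (fun _ : Fin n => E3) σ.symm
  convert h using 1
  ext k i
  simp [MeasurableEquiv.piCongrLeft, Equiv.piCongrLeft, Equiv.piCongrLeft']

/-- Completeness of the sectors, hence of Fock space, is what turns a trivial orthogonal complement
into density in `denseRange_resolvent`. -/
theorem isClosed_sector (n : ℕ) :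
    IsClosed (Sector n : Set (Lp ℂ 2 (volume : Measure (Fin n → E3)))) := by
  have : (Sector n : Set (Lp ℂ 2 (volume : Measure (Fin n → E3)))) =
      ⋂ σ : Equiv.Perm (Fin n),
        {φ | Lp.compMeasurePreserving (fun k => k ∘ σ) (measurePreserving_perm σ) φ = φ} := by
    ext φ
    simp only [Set.mem_iInter, Set.mem_ofPred_eq]
    refine forall_congr' fun σ => ?_
    have h := Lp.coeFn_compMeasurePreserving φ (measurePreserving_perm σ)
    constructor
    · intro h1
      refine Lp.ext ?_
      filter_upwards [h, h1] with k h2 h3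
      rw [h2, ← h3]
      rfl
    · intro h1
      rw [h1] at h
      filter_upwards [h] with k h2
      exact h2.symm
  rw [this]
  exact isClosed_iInter fun σ => isClosed_eq
    (Lp.isometry_compMeasurePreserving (measurePreserving_perm σ)).continuous continuous_id

instance (n : ℕ) : CompleteSpace (Sector n) := (isClosed_sector n).completeSpace_coe

/-- The symbol `1 + ω(k₁) + ⋯ + ω(kₙ)` of `Θ` on the `n`-particle space. -/
noncomputable def thetaSymbol {n : ℕ} (k : Fin n → E3) : ℝ := ∑ i, omega (k i) + 1

theorem omega_nonneg (x : E3) : 0 ≤ omega x := norm_nonneg x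

theorem continuous_omega : Continuous omega := continuous_norm

theorem one_le_thetaSymbol {n : ℕ} (k : Fin n → E3) : 1 ≤ thetaSymbol k :=
  le_add_of_nonneg_left (Finset.sum_nonneg fun i _ => omega_nonneg (k i))

theorem thetaSymbol_pos {n : ℕ} (k : Fin n → E3) : 0 < thetaSymbol k :=
  zero_lt_one.trans_le (one_le_thetaSymbol k)

theorem thetaSymbol_ne_zero {n : ℕ} (k : Fin n → E3) : (thetaSymbol k : ℂ) ≠ 0 :=
  Complex.ofReal_ne_zero.2 (thetaSymbol_pos k).ne'

theorem continuous_thetaSymbol (n : ℕ) : Continuous (thetaSymbol : (Fin n → E3) → ℝ) := by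
  unfold thetaSymbol
  have := continuous_omega
  fun_prop

theorem thetaSymbol_perm {n : ℕ} (k : Fin n → E3) (σ : Equiv.Perm (Fin n)) :
    thetaSymbol (k ∘ σ) = thetaSymbol k := by
  simp only [thetaSymbol, Function.comp_apply]
  rw [Equiv.sum_comp σ (fun i => omega (k i))]

theorem thetaSymbol_removeNth {n : ℕ} (k : Fin (n + 1) → E3) (i : Fin (n + 1)) :
    thetaSymbol k = omega (k i) + thetaSymbol (i.removeNth k) := by
  simp only [thetaSymbol, Fin.sum_univ_succAbove _ i, Fin.removeNth]
  ring

theorem thetaSymbol_cons {n : ℕ} (x : E3) (k : Fin n → E3) :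
    thetaSymbol (Fin.cons x k : Fin (n + 1) → E3) = omega x + thetaSymbol k := by
  simp only [thetaSymbol, Fin.sum_univ_succ, Fin.cons_zero, Fin.cons_succ]
  ring

theorem mem_graph_Theta {ψ φ : FockSpace} :
    (ψ, φ) ∈ Theta.graph ↔ ∀ m, ∀ᵐ k, comp φ m k = (thetaSymbol k : ℂ) * comp ψ m k := by
  rw [Theta, mem_graph_add_idOp, dGamma_graph]
  refine forall_congr' fun m => ⟨fun h => ?_, fun h => ?_⟩
  · filter_upwards [h, comp_sub φ ψ m] with k h1 h2
    rw [h2, sub_eq_iff_eq_add] at h1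
    rw [h1, thetaSymbol]
    push_cast
    ring
  · filter_upwards [h, comp_sub φ ψ m] with k h1 h2
    rw [h2, h1, thetaSymbol]
    push_cast
    ring

theorem exists_comp_eq_inv_thetaSymbol_mul (φ : FockSpace) :
    ∃ ψ : FockSpace, (∀ m, ∀ᵐ k, comp ψ m k = (thetaSymbol k : ℂ)⁻¹ * comp φ m k) ∧
      ‖ψ‖ ≤ 1 * ‖φ‖ := by
  have hle : ∑' m, ∫⁻ k : Fin m → E3, ‖(thetaSymbol k : ℂ)⁻¹ * comp φ m k‖ₑ ^ 2 ≤ ‖φ‖ₑ ^ 2 := by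
    rw [enorm_sq_eq_tsum]
    refine ENNReal.tsum_le_tsum fun m => lintegral_mono fun k => ?_
    gcongr
    rw [← ofReal_norm, ← ofReal_norm]
    refine ENNReal.ofReal_le_ofReal ?_
    rw [norm_mul, norm_inv, Complex.norm_real, Real.norm_of_nonneg (thetaSymbol_pos k).le]
    exact mul_le_of_le_one_left (norm_nonneg _) (inv_le_one_of_one_le₀ (one_le_thetaSymbol k))
  obtain ⟨ψ, hψ⟩ := exists_comp_eq (fun m k => (thetaSymbol k : ℂ)⁻¹ * comp φ m k)
    (fun m => by
      refine AEStronglyMeasurable.mul ?_ (memLp_comp φ m).1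
      exact (Complex.continuous_ofReal.comp
        (continuous_thetaSymbol m)).measurable.inv.aestronglyMeasurable)
    (fun m σ => by
      filter_upwards [comp_perm φ m σ] with k hk
      rw [hk, thetaSymbol_perm])
    (ne_top_of_le_ne_top (by simp) hle)
  refine ⟨ψ, hψ, ?_⟩
  have h1 : ‖ψ‖ₑ ^ 2 ≤ ‖φ‖ₑ ^ 2 := by
    rw [enorm_sq_eq_tsum]
    refine le_trans (le_of_eq ?_) hle
    refine tsum_congr fun m => lintegral_congr_ae ?_
    filter_upwards [hψ m] with k hk
    rw [hk]
  rw [one_mul]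
  exact (enorm_le_iff_norm_le.1 ((ENNReal.pow_le_pow_left_iff two_ne_zero).1 h1))

theorem exists_resolvent : ∃ R : FockSpace →L[ℂ] FockSpace,
    ‖R‖ ≤ 1 ∧ ∀ φ, (φ, R φ) ∈ Theta.inverse.graph := by
  refine exists_continuousLinearMap_of_graph _ zero_le_one fun φ => ?_
  obtain ⟨ψ, hψ, hn⟩ := exists_comp_eq_inv_thetaSymbol_mul φ
  refine ⟨ψ, (mem_graph_inverse Theta_ker).2 (mem_graph_Theta.2 fun m => ?_), hn⟩
  filter_upwards [hψ m] with k hk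
  rw [hk, mul_inv_cancel_left₀ (thetaSymbol_ne_zero k)]

/-- The inverse `Θ⁻¹` as an everywhere defined bounded operator. -/
noncomputable def resolvent : FockSpace →L[ℂ] FockSpace := exists_resolvent.choose

theorem norm_resolvent_le : ‖resolvent‖ ≤ 1 := exists_resolvent.choose_spec.1

theorem mem_graph_Theta_inverse {φ ψ : FockSpace} :
    (φ, ψ) ∈ Theta.inverse.graph ↔ ψ = resolvent φ := by
  have h := exists_resolvent.choose_spec.2 φ
  exact ⟨fun h' => LinearPMap.mem_graph_snd_inj _ h' h rfl, fun h' => h' ▸ h⟩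

theorem comp_resolvent (φ : FockSpace) (m : ℕ) :
    ∀ᵐ k, comp (resolvent φ) m k = (thetaSymbol k : ℂ)⁻¹ * comp φ m k := by
  have h : (φ, resolvent φ) ∈ Theta.inverse.graph := mem_graph_Theta_inverse.2 rfl
  rw [mem_graph_inverse Theta_ker, mem_graph_Theta] at h
  filter_upwards [h m] with k hk
  rw [hk, inv_mul_cancel_left₀ (thetaSymbol_ne_zero k)]

theorem comp_resolvent_pow (φ : FockSpace) (n m : ℕ) :
    ∀ᵐ k, comp ((resolvent ^ n) φ) m k = ((thetaSymbol k : ℂ)⁻¹) ^ n * comp φ m k := by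
  induction n with
  | zero => simp
  | succ n ih =>
    rw [pow_succ']
    filter_upwards [ih, comp_resolvent ((resolvent ^ n) φ) m] with k h1 h2
    rw [mul_apply_eq_comp, h2, h1, pow_succ']
    ring

/-- The natural domain of `Θⁿ`, built up factor by factor, is the maximal one: if `θⁿ ψ` is square
integrable then so is `θʲ ψ` for `j ≤ n`, because `Θ⁻¹` is bounded. -/
theorem mem_graph_powOp_Theta {n : ℕ} {ψ φ : FockSpace} :
    (ψ, φ) ∈ (powOp Theta n).graph ↔
      ∀ m, ∀ᵐ k, comp φ m k = (thetaSymbol k : ℂ) ^ n * comp ψ m k := by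
  induction n generalizing φ with
  | zero =>
    rw [powOp, mem_graph_idOp]
    constructor
    · rintro rfl m
      simp
    · intro h
      refine ext_comp fun m => ?_
      simpa using h m
  | succ n ih =>
    rw [powOp, mem_graph_mulOp]
    constructor
    · rintro ⟨χ, h1, h2⟩ m
      filter_upwards [ih.1 h1 m, mem_graph_Theta.1 h2 m] with k h3 h4
      rw [h4, h3, pow_succ']
      ring
    · intro h
      refine ⟨resolvent φ, ih.2 fun m => ?_, mem_graph_Theta.2 fun m => ?_⟩
      · filter_upwards [h m, comp_resolvent φ m] with k h1 h2
        rw [h2, h1, pow_succ', mul_assoc, inv_mul_cancel_left₀ (thetaSymbol_ne_zero k)]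
      · filter_upwards [comp_resolvent φ m] with k h2
        rw [h2, mul_inv_cancel_left₀ (thetaSymbol_ne_zero k)]

theorem resolvent_pow_mem_graph (n : ℕ) (φ : FockSpace) :
    ((resolvent ^ n) φ, φ) ∈ (powOp Theta n).graph := by
  refine mem_graph_powOp_Theta.2 fun m => ?_
  filter_upwards [comp_resolvent_pow φ n m] with k hk
  rw [hk, ← mul_assoc, ← mul_pow, mul_inv_cancel₀ (thetaSymbol_ne_zero k), one_pow, one_mul]

/-- A vector orthogonal to its own image under `Θ⁻¹` vanishes, since `Θ⁻¹` multiplies by a positive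
function. -/
theorem eq_zero_of_inner_resolvent {ψ : FockSpace} (h : inner ℂ ψ (resolvent ψ) = 0) : ψ = 0 := by
  have hterm (m : ℕ) : inner ℂ (ψ m) (resolvent ψ m) =
      ((∫ k, (thetaSymbol k)⁻¹ * ‖comp ψ m k‖ ^ 2 : ℝ) : ℂ) := by
    rw [Submodule.coe_inner, L2.inner_def, ← integral_complex_ofReal]
    refine integral_congr_ae ?_
    filter_upwards [comp_resolvent ψ m] with k hk
    change inner ℂ (comp ψ m k) (comp (resolvent ψ) m k) = _
    rw [hk, RCLike.inner_apply, mul_assoc, Complex.mul_conj']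
    push_cast
    rfl
  have hint (m : ℕ) : Integrable fun k : Fin m → E3 => (thetaSymbol k)⁻¹ * ‖comp ψ m k‖ ^ 2 := by
    have := ((memLp_two_iff_integrable_sq_norm (memLp_comp ψ m).1).1 (memLp_comp ψ m))
    refine this.bdd_mul (c := 1)
      (continuous_thetaSymbol m).measurable.inv.aestronglyMeasurable (Filter.Eventually.of_forall fun k => ?_)
    rw [norm_inv, Real.norm_of_nonneg (thetaSymbol_pos k).le]
    exact inv_le_one_of_one_le₀ (one_le_thetaSymbol k)
  have hnn (m : ℕ) : 0 ≤ fun k : Fin m → E3 => (thetaSymbol k)⁻¹ * ‖comp ψ m k‖ ^ 2 := fun k =>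
    mul_nonneg (inv_nonneg.2 (thetaSymbol_pos k).le) (by positivity)
  have hs := lp.hasSum_inner (𝕜 := ℂ) ψ (resolvent ψ)
  simp only [hterm, h] at hs
  rw [← Complex.ofReal_zero, Complex.hasSum_ofReal] at hs
  have h0 := (hasSum_zero_iff_of_nonneg fun m => integral_nonneg (hnn m)).1 hs
  refine ext_comp fun m => ?_
  have h1 := (integral_eq_zero_iff_of_nonneg (hnn m) (hint m)).1 (congrFun h0 m)
  filter_upwards [h1, comp_zero m] with k h2 h3
  rw [h3]
  have h4 := (mul_eq_zero.1 h2).resolve_left (inv_ne_zero (thetaSymbol_pos k).ne')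
  simpa using h4

theorem denseRange_resolvent : DenseRange resolvent := by
  have h : (LinearMap.range (resolvent : FockSpace →ₗ[ℂ] FockSpace)).topologicalClosure = ⊤ := by
    rw [Submodule.topologicalClosure_eq_top_iff, Submodule.eq_bot_iff]
    intro ψ hψ
    apply eq_zero_of_inner_resolvent
    have h : inner ℂ (resolvent ψ) ψ = 0 := hψ _ ⟨ψ, rfl⟩
    rw [← inner_conj_symm, h, map_zero]
  exact Submodule.dense_iff_topologicalClosure_eq_top.2 h

/-- The form bound `⟨Θ⁻¹φ, Θ Θ⁻¹φ⟩ ≤ ‖φ‖²`. -/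
theorem tsum_lintegral_thetaSymbol_mul_resolvent_le (φ : FockSpace) :
    ∑' m, ∫⁻ k, ENNReal.ofReal (thetaSymbol k) * ‖comp (resolvent φ) m k‖ₑ ^ 2 ≤ ‖φ‖ₑ ^ 2 := by
  rw [enorm_sq_eq_tsum]
  refine ENNReal.tsum_le_tsum fun m => lintegral_mono_ae ?_
  filter_upwards [comp_resolvent φ m] with k hk
  have h1 := one_le_thetaSymbol k
  have h0 := thetaSymbol_pos k
  rw [hk, ← ofReal_norm, ← ofReal_norm, ← ENNReal.ofReal_pow (norm_nonneg _),
    ← ENNReal.ofReal_pow (norm_nonneg _), ← ENNReal.ofReal_mul h0.le]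
  refine ENNReal.ofReal_le_ofReal ?_
  rw [norm_mul, norm_inv, Complex.norm_real, Real.norm_of_nonneg h0.le, mul_pow, ← mul_assoc]
  refine mul_le_of_le_one_left (by positivity) ?_
  rw [inv_pow, pow_two, mul_inv, mul_inv_cancel_left₀ h0.ne']
  exact inv_le_one_of_one_le₀ h1

/-! ### Integral bounds for creation and annihilation -/

theorem quasi_eval {n : ℕ} (i : Fin n) :
    Measure.QuasiMeasurePreserving (fun k : Fin n → E3 => k i) volume volume :=
  Measure.quasiMeasurePreserving_eval _ i

theorem lintegral_mul_removeNth {n : ℕ} (i : Fin (n + 1)) {a : E3 → ENNReal}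
    {b : (Fin n → E3) → ENNReal} (ha : AEMeasurable a) (hb : AEMeasurable b) :
    ∫⁻ k : Fin (n + 1) → E3, a (k i) * b (i.removeNth k) = (∫⁻ x, a x) * ∫⁻ k, b k := by
  have h := (volume_preserving_piFinSuccAbove (fun _ : Fin (n + 1) => E3) i).lintegral_comp_emb
    (MeasurableEquiv.measurableEmbedding _) (fun p => a p.1 * b p.2)
  rw [← lintegral_prod_mul ha hb]
  exact h

/-- The pointwise form of the bound on the creation operator: by the arithmetic-geometric mean
inequality the cross term of `i ≠ j` is at most
`(Uᵢ² wⱼ pᵢ² + Uⱼ² wᵢ pⱼ²) / 2`, so no cross term has to be integrated. -/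
theorem sq_sum_mul_le {n : ℕ} (a p U w : Fin (n + 1) → ℝ) (ha : ∀ i, 0 ≤ a i)
    (hp : ∀ i, 0 ≤ p i) (hw : ∀ i, 0 ≤ w i) (h1 : ∀ i, a i ≤ U i) (h2 : ∀ i, a i ≤ √(w i) * U i) :
    (∑ i, a i * p i) ^ 2 ≤ ∑ i, U i ^ 2 * ((∑ j, w (i.succAbove j) + 1) * p i ^ 2) := by
  let M : Fin (n + 1) → Fin (n + 1) → ℝ := fun i j =>
    if i = j then U i ^ 2 * p i ^ 2 else U i ^ 2 * w j * p i ^ 2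
  have hM (i j : Fin (n + 1)) : a i * p i * (a j * p j) ≤ (M i j + M j i) / 2 := by
    by_cases hij : i = j
    · subst hij
      have h3 : a i * p i ≤ U i * p i := mul_le_mul_of_nonneg_right (h1 i) (hp i)
      have h4 := pow_le_pow_left₀ (mul_nonneg (ha i) (hp i)) h3 2
      simp only [M, if_true]
      nlinarith
    · simp only [M, if_neg hij, if_neg (Ne.symm hij)]
      have h5 : a i * a j ≤ (√(w i) * U i) * (√(w j) * U j) :=
        mul_le_mul (h2 i) (h2 j) (ha j) ((ha i).trans (h2 i))
      have h6 := mul_le_mul_of_nonneg_right h5 (mul_nonneg (hp i) (hp j))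
      have h7 := two_mul_le_add_sq (U i * √(w j) * p i) (U j * √(w i) * p j)
      simp only [mul_pow, Real.sq_sqrt (hw _)] at h7
      nlinarith
  have hsum (i : Fin (n + 1)) :
      ∑ j, M i j = U i ^ 2 * ((∑ j, w (i.succAbove j) + 1) * p i ^ 2) := by
    rw [Fin.sum_univ_succAbove _ i]
    simp only [M, if_true, if_neg (Fin.ne_succAbove i _)]
    rw [← Finset.sum_mul, ← Finset.mul_sum]
    ring
  calc (∑ i, a i * p i) ^ 2 = ∑ i, ∑ j, a i * p i * (a j * p j) := by
        rw [pow_two, Finset.sum_mul_sum]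
    _ ≤ ∑ i, ∑ j, (M i j + M j i) / 2 :=
        Finset.sum_le_sum fun i _ => Finset.sum_le_sum fun j _ => hM i j
    _ = ∑ i, ∑ j, M i j := by
        simp only [add_div, Finset.sum_add_distrib]
        rw [Finset.sum_comm (f := fun i j => M j i / 2), ← Finset.sum_add_distrib]
        refine Finset.sum_congr rfl fun i _ => ?_
        rw [← Finset.sum_add_distrib]
        simp
    _ = _ := Finset.sum_congr rfl fun i _ => hsum i

/-- The integral `⟨ψₘ, Θ ψₘ⟩` of the `m`-particle component. -/
noncomputable def thetaForm (ψ : FockSpace) (m : ℕ) : ENNReal :=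
  ∫⁻ k, ENNReal.ofReal (thetaSymbol k) * ‖comp ψ m k‖ₑ ^ 2

theorem aemeasurable_thetaForm (ψ : FockSpace) (m : ℕ) :
    AEMeasurable fun k => ENNReal.ofReal (thetaSymbol k) * ‖comp ψ m k‖ₑ ^ 2 :=
  (continuous_thetaSymbol m).measurable.ennreal_ofReal.aemeasurable.mul
    ((memLp_comp ψ m).1.enorm.pow_const 2)

/-- `‖(a*(g) ψ)ₙ₊₁‖² ≤ ‖G‖² ⟨ψₙ, Θ ψₙ⟩`. The `i`-th term of the pointwise bound is a product of a
function of `kᵢ` and one of the other momenta; all `n + 1` terms have the same integral, which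
compensates the factor `(n + 1)⁻¹`. -/
theorem lintegral_creation_le {g : OneParticle} {G : E3 → ℂ} (hG : MemLp G 2 volume)
    (h1 : ∀ᵐ x, ‖g x‖ ≤ ‖G x‖) (h2 : ∀ᵐ x, ‖g x‖ ≤ √(omega x) * ‖G x‖) (ψ : FockSpace) (n : ℕ) :
    ∫⁻ k : Fin (n + 1) → E3, ‖(((√(n + 1 : ℝ))⁻¹ : ℝ) : ℂ) *
        ∑ i, g (k i) * comp ψ n (i.removeNth k)‖ₑ ^ 2 ≤
      (∫⁻ x, ‖G x‖ₑ ^ 2) * thetaForm ψ n := by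
  have hae : ∀ᵐ k : Fin (n + 1) → E3, ∀ i, ‖g (k i)‖ ≤ ‖G (k i)‖ ∧
      ‖g (k i)‖ ≤ √(omega (k i)) * ‖G (k i)‖ :=
    ae_all_iff.2 fun i => (quasi_eval i).ae (h1.and h2)
  have hpt : ∀ᵐ k : Fin (n + 1) → E3, ‖(((√(n + 1 : ℝ))⁻¹ : ℝ) : ℂ) *
        ∑ i, g (k i) * comp ψ n (i.removeNth k)‖ₑ ^ 2 ≤
      (n + 1 : ENNReal)⁻¹ * ∑ i, ‖G (k i)‖ₑ ^ 2 * (ENNReal.ofReal (thetaSymbol (i.removeNth k)) *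
        ‖comp ψ n (i.removeNth k)‖ₑ ^ 2) := by
    filter_upwards [hae] with k hk
    have hn : (n + 1 : ENNReal)⁻¹ = ENNReal.ofReal (n + 1 : ℝ)⁻¹ := by
      rw [ENNReal.ofReal_inv_of_pos (by positivity), ENNReal.ofReal_add (by positivity) zero_le_one]
      simp
    have hr : ∑ i, ‖G (k i)‖ₑ ^ 2 * (ENNReal.ofReal (thetaSymbol (i.removeNth k)) *
        ‖comp ψ n (i.removeNth k)‖ₑ ^ 2) = ENNReal.ofReal (∑ i, ‖G (k i)‖ ^ 2 *
          (thetaSymbol (i.removeNth k) * ‖comp ψ n (i.removeNth k)‖ ^ 2)) := by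
      rw [ENNReal.ofReal_sum_of_nonneg fun i _ => mul_nonneg (by positivity)
        (mul_nonneg (thetaSymbol_pos _).le (by positivity))]
      refine Finset.sum_congr rfl fun i _ => ?_
      rw [ENNReal.ofReal_mul (by positivity), ENNReal.ofReal_mul (thetaSymbol_pos _).le,
        ENNReal.ofReal_pow (norm_nonneg _), ENNReal.ofReal_pow (norm_nonneg _), ofReal_norm,
        ofReal_norm]
    rw [hn, hr, ← ENNReal.ofReal_mul (by positivity), ← ofReal_norm,
      ← ENNReal.ofReal_pow (norm_nonneg _)]
    refine ENNReal.ofReal_le_ofReal ?_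
    rw [norm_mul, mul_pow, Complex.norm_real, norm_inv, inv_pow, Real.norm_eq_abs, sq_abs,
      Real.sq_sqrt (by positivity)]
    refine mul_le_mul_of_nonneg_left ?_ (by positivity)
    refine le_trans (pow_le_pow_left₀ (norm_nonneg _) (norm_sum_le _ _) 2) ?_
    simp only [norm_mul]
    exact sq_sum_mul_le (fun i => ‖g (k i)‖) (fun i => ‖comp ψ n (i.removeNth k)‖)
      (fun i => ‖G (k i)‖) (fun i => omega (k i)) (fun _ => norm_nonneg _) (fun _ => norm_nonneg _)
      (fun _ => omega_nonneg _) (fun i => (hk i).1) (fun i => (hk i).2)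
  refine (lintegral_mono_ae hpt).trans (le_of_eq ?_)
  have hmG : AEMeasurable fun x => ‖G x‖ₑ ^ 2 := hG.1.enorm.pow_const 2
  have hmψ := aemeasurable_thetaForm ψ n
  have hm (i : Fin (n + 1)) : AEMeasurable fun k : Fin (n + 1) → E3 =>
      ‖G (k i)‖ₑ ^ 2 * (ENNReal.ofReal (thetaSymbol (i.removeNth k)) *
        ‖comp ψ n (i.removeNth k)‖ₑ ^ 2) :=
    (hmG.comp_quasiMeasurePreserving (quasi_eval i)).mul
      (hmψ.comp_quasiMeasurePreserving (quasi_removeNth i))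
  rw [lintegral_const_mul' _ _ (by simp), lintegral_finsetSum' _ fun i _ => hm i]
  simp only [lintegral_mul_removeNth _ hmG hmψ, Finset.sum_const, Finset.card_univ,
    Fintype.card_fin, nsmul_eq_mul, thetaForm]
  rw [← mul_assoc, Nat.cast_add, Nat.cast_one, ENNReal.inv_mul_cancel (by simp) (by simp), one_mul]

/-- By symmetry, `n + 1` times the energy of the zeroth particle is the total energy. -/
theorem lintegral_omega_zero_mul_le (ψ : FockSpace) (n : ℕ) :
    (n + 1 : ENNReal) * ∫⁻ k : Fin (n + 1) → E3, ENNReal.ofReal (omega (k 0)) *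
      ‖comp ψ (n + 1) k‖ₑ ^ 2 ≤ thetaForm ψ (n + 1) := by
  have hm (i : Fin (n + 1)) : AEMeasurable fun k : Fin (n + 1) → E3 =>
      ENNReal.ofReal (omega (k i)) * ‖comp ψ (n + 1) k‖ₑ ^ 2 :=
    ((continuous_omega.comp (continuous_apply i)).measurable.ennreal_ofReal.aemeasurable).mul
      ((memLp_comp ψ (n + 1)).1.enorm.pow_const 2)
  have h (i : Fin (n + 1)) :
      ∫⁻ k : Fin (n + 1) → E3, ENNReal.ofReal (omega (k 0)) * ‖comp ψ (n + 1) k‖ₑ ^ 2 =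
        ∫⁻ k : Fin (n + 1) → E3, ENNReal.ofReal (omega (k i)) * ‖comp ψ (n + 1) k‖ₑ ^ 2 := by
    have hp := measurePreserving_perm (Equiv.swap 0 i)
    rw [← hp.map_eq, lintegral_map' (by rw [hp.map_eq]; exact hm 0) hp.measurable.aemeasurable, hp.map_eq]
    refine lintegral_congr_ae ?_
    filter_upwards [comp_perm ψ (n + 1) (Equiv.swap 0 i)] with k hk
    rw [hk]
    simp
  calc _ = ∑ i : Fin (n + 1), ∫⁻ k : Fin (n + 1) → E3,
        ENNReal.ofReal (omega (k i)) * ‖comp ψ (n + 1) k‖ₑ ^ 2 := by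
        simp [← h]
    _ = ∫⁻ k : Fin (n + 1) → E3, ∑ i : Fin (n + 1),
        ENNReal.ofReal (omega (k i)) * ‖comp ψ (n + 1) k‖ₑ ^ 2 :=
        (lintegral_finsetSum' _ fun i _ => hm i).symm
    _ ≤ thetaForm ψ (n + 1) := by
        refine lintegral_mono fun k => ?_
        simp only
        rw [← Finset.sum_mul, ← ENNReal.ofReal_sum_of_nonneg fun i _ => omega_nonneg (k i)]
        gcongr
        exact le_add_of_nonneg_right zero_le_one

/-- `‖(a(g) ψ)ₙ‖² ≤ ‖G‖² ⟨ψₙ₊₁, Θ ψₙ₊₁⟩`. -/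
theorem lintegral_annihilation_le {g : OneParticle} {G : E3 → ℂ} (hG : MemLp G 2 volume)
    (h2 : ∀ᵐ x, ‖g x‖ ≤ √(omega x) * ‖G x‖) (ψ : FockSpace) (n : ℕ) :
    ∫⁻ k : Fin n → E3, ‖((√(n + 1 : ℝ) : ℝ) : ℂ) *
        ∫ x, starRingEnd ℂ (g x) * comp ψ (n + 1) (Fin.cons x k)‖ₑ ^ 2 ≤
      (∫⁻ x, ‖G x‖ₑ ^ 2) * thetaForm ψ (n + 1) := by
  have hcons : MeasurePreserving
      (fun q : (Fin n → E3) × E3 => (Fin.cons q.2 q.1 : Fin (n + 1) → E3))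
      (volume.prod volume) volume :=
    (measurePreserving_cons n).comp Measure.measurePreserving_swap
  have hmψ : AEStronglyMeasurable
      (fun q : (Fin n → E3) × E3 => comp ψ (n + 1) (Fin.cons q.2 q.1)) (volume.prod volume) :=
    (memLp_comp ψ (n + 1)).1.comp_measurePreserving hcons
  have hω : Measurable fun x => ENNReal.ofReal (omega x) :=
    continuous_omega.measurable.ennreal_ofReal
  have hslice : ∀ᵐ k : Fin n → E3, ‖((√(n + 1 : ℝ) : ℝ) : ℂ) *
        ∫ x, starRingEnd ℂ (g x) * comp ψ (n + 1) (Fin.cons x k)‖ₑ ^ 2 ≤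
      (n + 1 : ENNReal) * ((∫⁻ x, ‖G x‖ₑ ^ 2) *
        ∫⁻ x, ENNReal.ofReal (omega x) * ‖comp ψ (n + 1) (Fin.cons x k)‖ₑ ^ 2) := by
    filter_upwards [hmψ.prodMk_left] with k hk
    have hc : ‖((√(n + 1 : ℝ) : ℝ) : ℂ)‖ₑ ^ 2 = (n + 1 : ENNReal) := by
      rw [← ofReal_norm, ← ENNReal.ofReal_pow (norm_nonneg _), Complex.norm_real,
        Real.norm_eq_abs, sq_abs, Real.sq_sqrt (by positivity),
        ENNReal.ofReal_add (by positivity) zero_le_one]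
      simp
    rw [enorm_mul, mul_pow, hc]
    gcongr
    have hCS := ENNReal.lintegral_mul_le_Lp_mul_Lq volume Real.HolderConjugate.two_two
      (f := fun x => ‖G x‖ₑ)
      (g := fun x => ENNReal.ofReal √(omega x) * ‖comp ψ (n + 1) (Fin.cons x k)‖ₑ)
      hG.1.enorm ((continuous_omega.sqrt.measurable.ennreal_ofReal.aemeasurable).mul hk.enorm)
    have hle : ‖∫ x, starRingEnd ℂ (g x) * comp ψ (n + 1) (Fin.cons x k)‖ₑ ≤
        ∫⁻ x, ‖G x‖ₑ * (ENNReal.ofReal √(omega x) * ‖comp ψ (n + 1) (Fin.cons x k)‖ₑ) := by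
      refine (enorm_integral_le_lintegral_enorm _).trans (lintegral_mono_ae ?_)
      filter_upwards [h2] with x hx
      rw [enorm_mul, RCLike.enorm_conj, ← mul_assoc]
      gcongr
      rw [← ofReal_norm, ← ofReal_norm, ← ENNReal.ofReal_mul (norm_nonneg _), mul_comm]
      exact ENNReal.ofReal_le_ofReal hx
    refine (pow_le_pow_left₀ zero_le (hle.trans hCS) 2).trans (le_of_eq ?_)
    rw [mul_pow]
    have hsq (t : ENNReal) : (t ^ (1 / 2 : ℝ)) ^ 2 = t := by
      rw [← ENNReal.rpow_natCast, ← ENNReal.rpow_mul]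
      norm_num
    simp only [hsq, ENNReal.rpow_ofNat, mul_pow]
    congr 2
    funext x
    rw [← ENNReal.ofReal_pow (Real.sqrt_nonneg _), Real.sq_sqrt (omega_nonneg x)]
  refine (lintegral_mono_ae hslice).trans ?_
  have hm : AEMeasurable (fun k : Fin (n + 1) → E3 =>
      ENNReal.ofReal (omega (k 0)) * ‖comp ψ (n + 1) k‖ₑ ^ 2) :=
    ((hω.comp (measurable_pi_apply 0)).aemeasurable).mul
      ((memLp_comp ψ (n + 1)).1.enorm.pow_const 2)
  have hfub : ∫⁻ k : Fin n → E3, ∫⁻ x, ENNReal.ofReal (omega x) *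
        ‖comp ψ (n + 1) (Fin.cons x k)‖ₑ ^ 2 =
      ∫⁻ k : Fin (n + 1) → E3, ENNReal.ofReal (omega (k 0)) * ‖comp ψ (n + 1) k‖ₑ ^ 2 := by
    have h3 := hcons.map_eq
    conv_rhs => rw [← h3]
    rw [lintegral_map' (by rw [h3]; exact hm) hcons.measurable.aemeasurable, lintegral_prod]
    · rfl
    · exact hm.comp_quasiMeasurePreserving hcons.quasiMeasurePreserving
  rw [lintegral_const_mul' _ _ (by simp)]
  have hGtop : ∫⁻ x, ‖G x‖ₑ ^ 2 ≠ ⊤ := by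
    have := eLpNorm_nnreal_pow_eq_lintegral (f := G) (p := 2) (μ := volume) (by simp)
    simp only [NNReal.coe_ofNat, ENNReal.rpow_ofNat, ENNReal.coe_ofNat] at this
    rw [← this]
    exact ENNReal.pow_ne_top hG.2.ne
  rw [lintegral_const_mul' _ _ hGtop, hfub, mul_left_comm]
  gcongr
  exact lintegral_omega_zero_mul_le ψ n

/-! ### `a(g) Θ⁻¹` and `a*(g) Θ⁻¹` on all of Fock space -/

/-- Permuting the momenta and then omitting one amounts to omitting another one and permuting the
rest. -/
theorem removeNth_comp_perm {n : ℕ} (σ : Equiv.Perm (Fin (n + 1))) (i : Fin (n + 1)) :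
    ∃ τ : Equiv.Perm (Fin n), ∀ k : Fin (n + 1) → E3,
      i.removeNth (k ∘ σ) = ((σ i).removeNth k) ∘ τ := by
  refine ⟨(finSuccAboveEquiv i).trans
    ((σ.subtypeEquiv (q := fun j => j ≠ σ i) fun j => by simp).trans
      (finSuccAboveEquiv (σ i)).symm), fun k => ?_⟩
  funext j
  have h := congrArg Subtype.val ((finSuccAboveEquiv (σ i)).apply_symm_apply
    (σ.subtypeEquiv (q := fun j => j ≠ σ i) (fun j => by simp) (finSuccAboveEquiv i j)))
  simp only [finSuccAboveEquiv_apply, Equiv.subtypeEquiv_apply] at h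
  simp only [Fin.removeNth, Function.comp_apply, Equiv.trans_apply, finSuccAboveEquiv_apply,
    Equiv.subtypeEquiv_apply, h]

theorem cons_comp_perm {n : ℕ} (σ : Equiv.Perm (Fin n)) :
    ∃ τ : Equiv.Perm (Fin (n + 1)), ∀ (x : E3) (k : Fin n → E3),
      (Fin.cons x (k ∘ σ) : Fin (n + 1) → E3) = (Fin.cons x k : Fin (n + 1) → E3) ∘ τ := by
  refine ⟨Equiv.Perm.decomposeFin.symm (0, σ), fun x k => ?_⟩
  funext j
  refine Fin.cases ?_ (fun j => ?_) j
  · simp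
  · simp

theorem lintegral_enorm_sq_eq {G : E3 → ℂ} (hG : MemLp G 2 volume) :
    ∫⁻ x, ‖G x‖ₑ ^ 2 = ENNReal.ofReal (normL2 G ^ 2) := by
  have := eLpNorm_nnreal_pow_eq_lintegral (f := G) (p := 2) (μ := volume) (by simp)
  simp only [NNReal.coe_ofNat, ENNReal.rpow_ofNat, ENNReal.coe_ofNat] at this
  rw [← this, normL2, ENNReal.ofReal_pow ENNReal.toReal_nonneg, ENNReal.ofReal_toReal hG.2.ne]

theorem normL2_nonneg (G : E3 → ℂ) : 0 ≤ normL2 G := ENNReal.toReal_nonneg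

/-- Components bounded in total by `‖G‖² ⟨R φ, Θ R φ⟩` define a Fock space vector of norm at most
`‖G‖ ‖φ‖`. -/
theorem exists_comp_eq_of_le {G : E3 → ℂ} (hG : MemLp G 2 volume) {φ : FockSpace}
    (F : ∀ m, (Fin m → E3) → ℂ)
    (hm : ∀ m, AEStronglyMeasurable (F m) volume)
    (hsym : ∀ m, ∀ σ : Equiv.Perm (Fin m), ∀ᵐ k, F m (k ∘ σ) = F m k)
    (hF : ∑' m, ∫⁻ k, ‖F m k‖ₑ ^ 2 ≤ (∫⁻ x, ‖G x‖ₑ ^ 2) * ∑' m, thetaForm (resolvent φ) m) :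
    ∃ χ : FockSpace, (∀ m, ∀ᵐ k, comp χ m k = F m k) ∧ ‖χ‖ ≤ normL2 G * ‖φ‖ := by
  have hle : ∑' m, ∫⁻ k, ‖F m k‖ₑ ^ 2 ≤ ENNReal.ofReal ((normL2 G * ‖φ‖) ^ 2) := by
    refine hF.trans ?_
    rw [lintegral_enorm_sq_eq hG, mul_pow, ENNReal.ofReal_mul (by positivity),
      ENNReal.ofReal_pow (norm_nonneg φ), ofReal_norm]
    gcongr
    exact tsum_lintegral_thetaSymbol_mul_resolvent_le φ
  obtain ⟨χ, hχ⟩ := exists_comp_eq F hm hsym (ne_top_of_le_ne_top ENNReal.ofReal_ne_top hle)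
  refine ⟨χ, hχ, ?_⟩
  have h1 : ENNReal.ofReal (‖χ‖ ^ 2) ≤ ENNReal.ofReal ((normL2 G * ‖φ‖) ^ 2) := by
    rw [ENNReal.ofReal_pow (norm_nonneg χ), ofReal_norm, enorm_sq_eq_tsum]
    refine le_trans (le_of_eq ?_) hle
    refine tsum_congr fun m => lintegral_congr_ae ?_
    filter_upwards [hχ m] with k hk
    rw [hk]
  have hnn := mul_nonneg (normL2_nonneg G) (norm_nonneg φ)
  exact (pow_le_pow_iff_left₀ (norm_nonneg _) hnn two_ne_zero).1
    ((ENNReal.ofReal_le_ofReal_iff (by positivity)).1 h1)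

theorem exists_creation_resolvent {g : OneParticle} {G : E3 → ℂ} (hG : MemLp G 2 volume)
    (h1 : ∀ᵐ x, ‖g x‖ ≤ ‖G x‖) (h2 : ∀ᵐ x, ‖g x‖ ≤ √(omega x) * ‖G x‖) (φ : FockSpace) :
    ∃ χ, (resolvent φ, χ) ∈ (creation g).graph ∧ ‖χ‖ ≤ normL2 G * ‖φ‖ := by
  let F : ∀ m, (Fin m → E3) → ℂ := fun m => match m with
    | 0 => fun _ => 0
    | n + 1 => fun k => (((√(n + 1 : ℝ))⁻¹ : ℝ) : ℂ) *
        ∑ i, g (k i) * comp (resolvent φ) n (i.removeNth k)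
  obtain ⟨χ, hχ, hn⟩ := exists_comp_eq_of_le hG (φ := φ) F
    (fun m => by
      cases m with
      | zero => exact aestronglyMeasurable_const
      | succ n =>
        refine AEStronglyMeasurable.const_mul (Finset.aestronglyMeasurable_fun_sum _ fun i _ => ?_) _
        exact ((Lp.memLp g).1.comp_quasiMeasurePreserving (quasi_eval i)).mul
          ((memLp_comp (resolvent φ) n).1.comp_quasiMeasurePreserving (quasi_removeNth i)))
    (fun m σ => by
      cases m with
      | zero => exact Filter.Eventually.of_forall fun k => rfl
      | succ n =>
        choose τ hτ using removeNth_comp_perm σ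
        have h : ∀ᵐ k : Fin (n + 1) → E3, ∀ i, comp (resolvent φ) n (((σ i).removeNth k) ∘ τ i) =
            comp (resolvent φ) n ((σ i).removeNth k) :=
          ae_all_iff.2 fun i => (quasi_removeNth (σ i)).ae (comp_perm (resolvent φ) n (τ i))
        filter_upwards [h] with k hk
        simp only [F]
        congr 1
        rw [← Equiv.sum_comp σ (fun i => g (k i) * comp (resolvent φ) n (i.removeNth k))]
        refine Finset.sum_congr rfl fun i _ => ?_
        rw [hτ, hk, Function.comp_apply])
    (by
      rw [tsum_eq_zero_add' ENNReal.summable]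
      simp only [F, enorm_zero, ne_eq, OfNat.ofNat_ne_zero, not_false_eq_true, zero_pow,
        lintegral_zero, zero_add]
      rw [← ENNReal.tsum_mul_left]
      exact ENNReal.tsum_le_tsum fun n => lintegral_creation_le hG h1 h2 (resolvent φ) n)
  refine ⟨χ, ?_, hn⟩
  rw [creation_graph]
  exact ⟨hχ 0, fun n => hχ (n + 1)⟩

theorem exists_annihilation_resolvent {g : OneParticle} {G : E3 → ℂ} (hG : MemLp G 2 volume)
    (h2 : ∀ᵐ x, ‖g x‖ ≤ √(omega x) * ‖G x‖) (φ : FockSpace) :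
    ∃ χ, (resolvent φ, χ) ∈ (annihilation g).graph ∧ ‖χ‖ ≤ normL2 G * ‖φ‖ := by
  obtain ⟨χ, hχ, hn⟩ := exists_comp_eq_of_le hG (φ := φ)
    (fun n k => ((√(n + 1 : ℝ) : ℝ) : ℂ) *
        ∫ x, starRingEnd ℂ (g x) * comp (resolvent φ) (n + 1) (Fin.cons x k))
    (fun n => by
      refine AEStronglyMeasurable.const_mul ?_ _
      have hcons : MeasurePreserving
          (fun q : (Fin n → E3) × E3 => (Fin.cons q.2 q.1 : Fin (n + 1) → E3))
          (volume.prod volume) volume :=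
        (measurePreserving_cons n).comp Measure.measurePreserving_swap
      have hm := (memLp_comp (resolvent φ) (n + 1)).1.comp_measurePreserving hcons
      have hg : AEStronglyMeasurable (fun q : (Fin n → E3) × E3 => starRingEnd ℂ (g q.2))
          (volume.prod volume) :=
        (Lp.memLp g).star.1.comp_quasiMeasurePreserving Measure.quasiMeasurePreserving_snd
      exact (hg.mul hm).integral_prod_right')
    (fun n σ => by
      obtain ⟨τ, hτ⟩ := cons_comp_perm σ
      filter_upwards [ae_slice (comp_perm (resolvent φ) (n + 1) τ)] with k hk
      congr 1
      refine integral_congr_ae ?_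
      filter_upwards [hk] with x hx
      rw [hτ, hx])
    (by
      rw [← ENNReal.tsum_mul_left]
      refine (ENNReal.tsum_le_tsum fun n => lintegral_annihilation_le hG h2 (resolvent φ) n).trans ?_
      exact ENNReal.tsum_comp_le_tsum_of_injective (add_left_injective 1)
        (fun m => (∫⁻ x, ‖G x‖ₑ ^ 2) * thetaForm (resolvent φ) m))
  refine ⟨χ, ?_, hn⟩
  rw [annihilation_graph]
  exact hχ

/-! ### The commutator identities -/

/-- The binomial expansion of `(a + t)ⁿ`, with the term `j = 0` set apart and `tⁿ⁻ʲ` written as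
`t⁻ʲ tⁿ`. It is used with `t` the symbol of `Θ` and `a = ± ω`. -/
theorem sum_choose_mul_pow_add (n : ℕ) (a t u v : ℂ) (ht : t ≠ 0) :
    ∑ j ∈ Finset.Icc 1 n, (n.choose j : ℂ) * (a ^ j * u * (t⁻¹ ^ j * (t ^ n * v))) +
      u * (t ^ n * v) = (a + t) ^ n * (u * v) := by
  have h : ∑ j ∈ Finset.Icc 1 n, (n.choose j : ℂ) * (a ^ j * (t⁻¹ ^ j * t ^ n)) + t ^ n =
      (a + t) ^ n := by
    rw [add_pow, Finset.range_eq_Ico, Finset.sum_eq_sum_Ico_succ_bot (Nat.succ_pos n), add_comm]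
    congr 1
    · simp
    · refine Finset.sum_congr rfl fun j hj => ?_
      have hj' : j ≤ n := (Finset.mem_Icc.1 hj).2
      rw [inv_pow, pow_sub₀ t ht hj']
      ring
  rw [← h, add_mul, Finset.sum_mul]
  congr 1
  · exact Finset.sum_congr rfl fun j _ => by ring
  · ring

theorem comp_sum_smul_add {n : ℕ} (c : ℕ → ℂ) (χ : ℕ → FockSpace) (z : FockSpace) (m : ℕ) :
    ∀ᵐ k, comp (∑ j ∈ Finset.Icc 1 n, c j • χ j + z) m k =
      ∑ j ∈ Finset.Icc 1 n, c j * comp (χ j) m k + comp z m k := by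
  have h : ∀ᵐ k, ∀ j, comp (c j • χ j) m k = c j * comp (χ j) m k :=
    ae_all_iff.2 fun j => comp_smul (c j) (χ j) m
  filter_upwards [comp_add (∑ j ∈ Finset.Icc 1 n, c j • χ j) z m,
    comp_sum (Finset.Icc 1 n) (fun j => c j • χ j) m, h] with k h1 h2 h3
  rw [h1, h2]
  simp only [h3]

/-- The identity `Θⁿ a*(f) = ∑ⱼ C(n, j) a*(ωʲ f) Θ⁻ʲ Θⁿ + a*(f) Θⁿ`, with `g j = ωʲ f`. -/
theorem powOp_Theta_creation {n : ℕ} {f : OneParticle} {g : ℕ → OneParticle}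
    (hg : ∀ j ∈ Finset.Icc 1 n, ∀ᵐ x, g j x = ((omega x ^ j : ℝ) : ℂ) * f x)
    {ψ φ y z : FockSpace} {χ : ℕ → FockSpace} (hφ : (ψ, φ) ∈ (powOp Theta n).graph)
    (hy : (ψ, y) ∈ (creation f).graph) (hz : (φ, z) ∈ (creation f).graph)
    (hχ : ∀ j ∈ Finset.Icc 1 n, ((resolvent ^ j) φ, χ j) ∈ (creation (g j)).graph) :
    (y, ∑ j ∈ Finset.Icc 1 n, (n.choose j : ℂ) • χ j + z) ∈ (powOp Theta n).graph := by
  simp only [creation_graph] at hy hz hχ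
  rw [mem_graph_powOp_Theta] at hφ ⊢
  intro m
  have hsum := comp_sum_smul_add (n := n) (fun j => (n.choose j : ℂ)) χ z m
  cases m with
  | zero =>
    have h0 : ∀ᵐ k, ∀ j ∈ Finset.Icc 1 n, comp (χ j) 0 k = 0 :=
      (Filter.eventually_all_finset _).2 fun j hj => (hχ j hj).1
    filter_upwards [hsum, h0, hy.1, hz.1] with k h1 h2 h3 h4
    rw [h1, h3, h4, Finset.sum_eq_zero fun j hj => by rw [h2 j hj, mul_zero]]
    simp
  | succ m =>
    have h0 : ∀ᵐ k, ∀ j ∈ Finset.Icc 1 n, comp (χ j) (m + 1) k = (((√(m + 1 : ℝ))⁻¹ : ℝ) : ℂ) *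
        ∑ i, g j (k i) * comp ((resolvent ^ j) φ) m (i.removeNth k) :=
      (Filter.eventually_all_finset _).2 fun j hj => (hχ j hj).2 m
    have hg' : ∀ᵐ k : Fin (m + 1) → E3, ∀ j ∈ Finset.Icc 1 n, ∀ i,
        g j (k i) = ((omega (k i) ^ j : ℝ) : ℂ) * f (k i) :=
      (Filter.eventually_all_finset _).2 fun j hj => ae_all_iff.2 fun i =>
        (quasi_eval i).ae (hg j hj)
    have hR : ∀ᵐ k : Fin (m + 1) → E3, ∀ (i : Fin (m + 1)) (j : ℕ),
        comp ((resolvent ^ j) φ) m (i.removeNth k) =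
        ((thetaSymbol (i.removeNth k) : ℂ)⁻¹) ^ j * comp φ m (i.removeNth k) :=
      ae_all_iff.2 fun i => ae_all_iff.2 fun j => (quasi_removeNth i).ae (comp_resolvent_pow φ j m)
    have hφ' : ∀ᵐ k : Fin (m + 1) → E3, ∀ i : Fin (m + 1), comp φ m (i.removeNth k) =
        (thetaSymbol (i.removeNth k) : ℂ) ^ n * comp ψ m (i.removeNth k) :=
      ae_all_iff.2 fun i => (quasi_removeNth i).ae (hφ m)
    filter_upwards [hsum, h0, hy.2 m, hz.2 m, hg', hR, hφ'] with k h1 h2 h3 h4 h5 h6 h7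
    rw [h1, h3, h4, mul_left_comm, Finset.sum_congr rfl fun j hj => by
      rw [h2 j hj, mul_left_comm], ← Finset.mul_sum, ← mul_add]
    congr 1
    simp only [Finset.mul_sum]
    rw [Finset.sum_comm, ← Finset.sum_add_distrib]
    refine Finset.sum_congr rfl fun i _ => ?_
    rw [thetaSymbol_removeNth k i, Complex.ofReal_add, h7,
      ← sum_choose_mul_pow_add n _ _ _ _ (thetaSymbol_ne_zero _)]
    congr 1
    refine Finset.sum_congr rfl fun j hj => ?_
    rw [h5 j hj i, h6, h7, Complex.ofReal_pow]

/-- The identity `Θⁿ a(f) = ∑ⱼ (-1)ʲ C(n, j) a(ωʲ f) Θ⁻ʲ Θⁿ + a(f) Θⁿ`, with `g j = ωʲ f`. -/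
theorem powOp_Theta_annihilation {n : ℕ} {f : OneParticle} {g : ℕ → OneParticle}
    (hg : ∀ j ∈ Finset.Icc 1 n, ∀ᵐ x, g j x = ((omega x ^ j : ℝ) : ℂ) * f x)
    {ψ φ y z : FockSpace} {χ : ℕ → FockSpace} (hφ : (ψ, φ) ∈ (powOp Theta n).graph)
    (hy : (ψ, y) ∈ (annihilation f).graph) (hz : (φ, z) ∈ (annihilation f).graph)
    (hχ : ∀ j ∈ Finset.Icc 1 n, ((resolvent ^ j) φ, χ j) ∈ (annihilation (g j)).graph) :
    (y, ∑ j ∈ Finset.Icc 1 n, ((-1) ^ j * n.choose j : ℂ) • χ j + z) ∈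
      (powOp Theta n).graph := by
  simp only [annihilation_graph] at hy hz hχ
  rw [mem_graph_powOp_Theta] at hφ ⊢
  intro m
  have hsum := comp_sum_smul_add (n := n) (fun j => ((-1) ^ j * n.choose j : ℂ)) χ z m
  have h0 : ∀ᵐ k, ∀ j ∈ Finset.Icc 1 n, comp (χ j) m k = ((√(m + 1 : ℝ) : ℝ) : ℂ) *
      ∫ x, starRingEnd ℂ (g j x) * comp ((resolvent ^ j) φ) (m + 1) (Fin.cons x k) :=
    (Filter.eventually_all_finset _).2 fun j hj => hχ j hj m
  have hg' : ∀ᵐ x, ∀ j ∈ Finset.Icc 1 n, g j x = ((omega x ^ j : ℝ) : ℂ) * f x :=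
    (Filter.eventually_all_finset _).2 hg
  have hR : ∀ᵐ k : Fin m → E3, ∀ᵐ x, ∀ j, comp ((resolvent ^ j) φ) (m + 1) (Fin.cons x k) =
      ((thetaSymbol (Fin.cons x k : Fin (m + 1) → E3) : ℂ)⁻¹) ^ j *
        comp φ (m + 1) (Fin.cons x k) :=
    ae_slice (ae_all_iff.2 fun j => comp_resolvent_pow φ j (m + 1))
  have hi : ∀ᵐ k : Fin m → E3, ∀ j, Integrable fun x =>
      starRingEnd ℂ (g j x) * comp ((resolvent ^ j) φ) (m + 1) (Fin.cons x k) :=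
    ae_all_iff.2 fun j => integrable_slice (g j) _ m
  filter_upwards [hsum, h0, hy m, hz m, hR, hi, ae_slice (hφ (m + 1)), integrable_slice f ψ m,
    integrable_slice f φ m] with k h1 h2 h3 h4 h5 h6 h7 h8 h9
  rw [h1, h3, h4, mul_left_comm, Finset.sum_congr rfl fun j hj => by
    rw [h2 j hj, mul_left_comm, ← integral_const_mul], ← Finset.mul_sum, ← mul_add]
  congr 1
  rw [← integral_finsetSum _ fun j _ => (h6 j).const_mul _,
    ← integral_add (integrable_finsetSum _ fun j _ => (h6 j).const_mul _) h9,
    ← integral_const_mul]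
  refine integral_congr_ae ?_
  filter_upwards [hg', h5, h7] with x hx1 hx2 hx3
  have hT : (thetaSymbol k : ℂ) = -(omega x : ℂ) + thetaSymbol (Fin.cons x k : Fin (m + 1) → E3) := by
    rw [thetaSymbol_cons]
    push_cast
    ring
  rw [hT, hx3, ← sum_choose_mul_pow_add n _ _ _ _ (thetaSymbol_ne_zero _)]
  congr 1
  refine Finset.sum_congr rfl fun j hj => ?_
  rw [hx1 j hj, hx2, hx3, map_mul, Complex.conj_ofReal, neg_pow (omega x : ℂ),
    Complex.ofReal_pow, mul_comm ((-1 : ℂ) ^ j), mul_assoc (n.choose j : ℂ)]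
  simp only [mul_assoc]

/-! ### Domination of the form factors -/

theorem pow_le_pow_add_one {t : ℝ} (ht : 0 ≤ t) {j n : ℕ} (hj : j ≤ n) : t ^ j ≤ t ^ n + 1 := by
  rcases le_total t 1 with h | h
  · exact (pow_le_one₀ ht h).trans (le_add_of_nonneg_left (by positivity))
  · exact (pow_le_pow_right₀ h hj).trans (le_add_of_nonneg_right zero_le_one)

theorem pow_le_sqrt_mul_pow_add_one {t : ℝ} (ht : 0 ≤ t) {j : ℕ} (hj : 1 ≤ j) :
    t ^ j ≤ √t * (t ^ j + 1) := by
  rcases le_total t 1 with h | h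
  · have h1 : t ≤ √t := Real.le_sqrt_of_sq_le (by nlinarith)
    calc t ^ j ≤ t := pow_le_of_le_one ht h (by omega)
      _ ≤ √t * 1 := by rwa [mul_one]
      _ ≤ _ := by gcongr; exact le_add_of_nonneg_left (by positivity)
  · have h1 : 1 ≤ √t := Real.one_le_sqrt.2 h
    nlinarith [pow_nonneg ht j]

theorem one_le_sqrt_mul_rpow_add_one {t : ℝ} (ht : 0 < t) :
    1 ≤ √t * (t ^ (-1 / 2 : ℝ) + 1) := by
  have h : √t * t ^ (-1 / 2 : ℝ) = 1 := by
    rw [Real.sqrt_eq_rpow, ← Real.rpow_add ht]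
    norm_num
  rw [mul_add, h]
  exact le_add_of_nonneg_right (by positivity)

/-- The point `0`, where `ω^{-1/2}` takes the junk value `0`, is negligible. -/
theorem ae_omega_pos : ∀ᵐ x : E3, 0 < omega x := by
  filter_upwards [Measure.ae_ne volume (0 : E3)] with x hx
  exact norm_pos_iff.2 hx

theorem norm_ofReal_mul {s : ℝ} (hs : 0 ≤ s) (z : ℂ) : ‖(s : ℂ) * z‖ = s * ‖z‖ := by
  rw [norm_mul, Complex.norm_real, Real.norm_of_nonneg hs]

theorem memLp_add_one_mul {w : E3 → ℝ} {f : OneParticle}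
    (h : MemLp (fun x => (w x : ℂ) * f x) 2 volume) :
    MemLp (fun x => ((w x + 1 : ℝ) : ℂ) * f x) 2 volume := by
  refine (h.add (Lp.memLp f)).ae_eq (Filter.Eventually.of_forall fun x => ?_)
  simp only [Pi.add_apply]
  push_cast
  ring

theorem memLp_omega_pow_mul {n j : ℕ} {f : OneParticle} (hj : j ≤ n)
    (h : MemLp (fun x => ((omega x ^ n : ℝ) : ℂ) * f x) 2 volume) :
    MemLp (fun x => ((omega x ^ j : ℝ) : ℂ) * f x) 2 volume := by
  refine (memLp_add_one_mul h).mono ?_ (Filter.Eventually.of_forall fun x => ?_)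
  · exact (Complex.continuous_ofReal.comp (continuous_omega.pow j)).aestronglyMeasurable.mul
      (Lp.memLp f).1
  · have h0 := omega_nonneg x
    rw [norm_ofReal_mul (by positivity), norm_ofReal_mul (by positivity)]
    gcongr
    exact pow_le_pow_add_one h0 hj

theorem ae_norm_le_of_eq_omega_pow {j : ℕ} {f g : OneParticle}
    (hg : ∀ᵐ x, g x = ((omega x ^ j : ℝ) : ℂ) * f x) :
    ∀ᵐ x, ‖g x‖ ≤ ‖((omega x ^ j + 1 : ℝ) : ℂ) * f x‖ := by
  filter_upwards [hg] with x hx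
  have h0 := pow_nonneg (omega_nonneg x) j
  rw [hx, norm_ofReal_mul h0, norm_ofReal_mul (add_nonneg h0 zero_le_one)]
  exact mul_le_mul_of_nonneg_right (le_add_of_nonneg_right zero_le_one) (norm_nonneg _)

theorem ae_norm_le_sqrt_mul_of_eq_omega_pow {j : ℕ} (hj : 1 ≤ j) {f g : OneParticle}
    (hg : ∀ᵐ x, g x = ((omega x ^ j : ℝ) : ℂ) * f x) :
    ∀ᵐ x, ‖g x‖ ≤ √(omega x) * ‖((omega x ^ j + 1 : ℝ) : ℂ) * f x‖ := by
  filter_upwards [hg] with x hx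
  have h0 := pow_nonneg (omega_nonneg x) j
  rw [hx, norm_ofReal_mul h0, norm_ofReal_mul (add_nonneg h0 zero_le_one), ← mul_assoc]
  exact mul_le_mul_of_nonneg_right (pow_le_sqrt_mul_pow_add_one (omega_nonneg x) hj)
    (norm_nonneg _)

theorem ae_norm_le_rpow_add_one_mul (f : OneParticle) :
    ∀ᵐ x, ‖f x‖ ≤ ‖((omega x ^ (-1 / 2 : ℝ) + 1 : ℝ) : ℂ) * f x‖ := by
  refine Filter.Eventually.of_forall fun x => ?_
  have h0 := Real.rpow_nonneg (omega_nonneg x) (-1 / 2)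
  rw [norm_ofReal_mul (add_nonneg h0 zero_le_one)]
  exact le_mul_of_one_le_left (norm_nonneg _) (le_add_of_nonneg_left h0)

theorem ae_norm_le_sqrt_mul_rpow_add_one_mul (f : OneParticle) :
    ∀ᵐ x, ‖f x‖ ≤ √(omega x) * ‖((omega x ^ (-1 / 2 : ℝ) + 1 : ℝ) : ℂ) * f x‖ := by
  filter_upwards [ae_omega_pos] with x hx
  have h0 := Real.rpow_nonneg (omega_nonneg x) (-1 / 2)
  rw [norm_ofReal_mul (add_nonneg h0 zero_le_one), ← mul_assoc]
  exact le_mul_of_one_le_left (norm_nonneg _) (one_le_sqrt_mul_rpow_add_one hx)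

theorem resolvent_resolvent_pow (j : ℕ) (φ : FockSpace) :
    resolvent ((resolvent ^ j) φ) = (resolvent ^ (j + 1)) φ := by
  rw [pow_succ', mul_apply_eq_comp]

theorem resolvent_pow_resolvent (j : ℕ) (φ : FockSpace) :
    (resolvent ^ j) (resolvent φ) = (resolvent ^ (j + 1)) φ := by
  rw [pow_succ, mul_apply_eq_comp]

/-! ### Operator bounds -/

/-- The bound on `a g Θ⁻¹` by the norm of any `G` dominating `g` and `ω^{-1/2} g`, for a family of
operators `a g` depending on a form factor `g`. -/
def IsThetaBounded (a : OneParticle → FockSpace →ₗ.[ℂ] FockSpace) : Prop :=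
  ∀ (g : OneParticle) (G : E3 → ℂ), MemLp G 2 volume → (∀ᵐ x, ‖g x‖ ≤ ‖G x‖) →
    (∀ᵐ x, ‖g x‖ ≤ √(omega x) * ‖G x‖) → ∀ φ, ∃ χ, (resolvent φ, χ) ∈ (a g).graph ∧
      ‖χ‖ ≤ normL2 G * ‖φ‖

theorem IsThetaBounded.exists_continuousLinearMap
    {a : OneParticle → FockSpace →ₗ.[ℂ] FockSpace} (ha : IsThetaBounded a) {g : OneParticle}
    {G : E3 → ℂ} (hG : MemLp G 2 volume) (h1 : ∀ᵐ x, ‖g x‖ ≤ ‖G x‖)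
    (h2 : ∀ᵐ x, ‖g x‖ ≤ √(omega x) * ‖G x‖) :
    ∃ B : FockSpace →L[ℂ] FockSpace, ‖B‖ ≤ normL2 G ∧ ∀ φ, (resolvent φ, B φ) ∈ (a g).graph := by
  obtain ⟨B, hB, h⟩ := exists_continuousLinearMap_of_graph (mulOp (a g) Theta.inverse)
    (normL2_nonneg G) fun φ =>
      let ⟨χ, hχ, hn⟩ := ha g G hG h1 h2 φ
      ⟨χ, mem_graph_mulOp.2 ⟨_, mem_graph_Theta_inverse.2 rfl, hχ⟩, hn⟩
  refine ⟨B, hB, fun φ => ?_⟩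
  obtain ⟨ψ, h1, h2⟩ := mem_graph_mulOp.1 (h φ)
  rwa [mem_graph_Theta_inverse.1 h1] at h2

theorem IsThetaBounded.mulOp_Theta_inverse {a : OneParticle → FockSpace →ₗ.[ℂ] FockSpace}
    (ha : IsThetaBounded a) {f : OneParticle}
    (hf : MemLp (fun k => ((omega k ^ (-1 / 2 : ℝ) : ℝ) : ℂ) * f k) 2 volume) :
    (mulOp (a f) Theta.inverse).domain = ⊤ ∧
      OpNormLE (mulOp (a f) Theta.inverse)
        (normL2 fun k => ((omega k ^ (-1 / 2 : ℝ) + 1 : ℝ) : ℂ) * f k) := by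
  obtain ⟨B, hB, hBa⟩ := ha.exists_continuousLinearMap (memLp_add_one_mul hf)
    (ae_norm_le_rpow_add_one_mul f) (ae_norm_le_sqrt_mul_rpow_add_one_mul f)
  have hg (φ : FockSpace) : (φ, B φ) ∈ (mulOp (a f) Theta.inverse).graph :=
    mem_graph_mulOp.2 ⟨_, mem_graph_Theta_inverse.2 rfl, hBa φ⟩
  have hdom : (mulOp (a f) Theta.inverse).domain = ⊤ :=
    eq_top_iff.2 fun φ _ => LinearPMap.mem_domain_iff.2 ⟨_, hg φ⟩
  refine ⟨hdom, OpNormLE.of_graph B hB ?_ fun φ z hz =>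
    LinearPMap.mem_graph_snd_inj _ (hg φ) hz rfl⟩
  rw [hdom]
  exact dense_univ

/-- The form factors `ωʲ f` and the operators `a (ωʲ f) Θ⁻¹`, for `1 ≤ j ≤ n`. For other `j`, where
`ωʲ f` need not be square integrable, nothing is claimed. -/
theorem IsThetaBounded.exists_family {a : OneParticle → FockSpace →ₗ.[ℂ] FockSpace}
    (ha : IsThetaBounded a) {n : ℕ} {f : OneParticle}
    (hfn : MemLp (fun k => ((omega k ^ n : ℝ) : ℂ) * f k) 2 volume) (j : ℕ) :
    ∃ (g : OneParticle) (B : FockSpace →L[ℂ] FockSpace), j ∈ Finset.Icc 1 n →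
      (∀ᵐ x, g x = ((omega x ^ j : ℝ) : ℂ) * f x) ∧
      ‖B‖ ≤ (normL2 fun x => ((omega x ^ j + 1 : ℝ) : ℂ) * f x) ∧
      ∀ φ, (resolvent φ, B φ) ∈ (a g).graph := by
  by_cases hj : j ∈ Finset.Icc 1 n
  · obtain ⟨hj1, hjn⟩ := Finset.mem_Icc.1 hj
    have hL := memLp_omega_pow_mul hjn hfn
    obtain ⟨g, hg⟩ : ∃ g : OneParticle, ∀ᵐ x, g x = ((omega x ^ j : ℝ) : ℂ) * f x :=
      ⟨_, hL.coeFn_toLp⟩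
    obtain ⟨B, hB⟩ := ha.exists_continuousLinearMap (memLp_add_one_mul hL)
      (ae_norm_le_of_eq_omega_pow hg) (ae_norm_le_sqrt_mul_of_eq_omega_pow hj1 hg)
    exact ⟨g, B, fun _ => ⟨hg, hB⟩⟩
  · exact ⟨0, 0, fun h => absurd h hj⟩

/-- The commutator bound, from an expansion of `[Θⁿ, a f] Θ⁻ⁿ` into the operators
`a (ωʲ f) Θ⁻ʲ`, `1 ≤ j ≤ n`, with coefficients at most `C(n, j)`. -/
theorem IsThetaBounded.commOp_powOp_Theta {a : OneParticle → FockSpace →ₗ.[ℂ] FockSpace}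
    (ha : IsThetaBounded a) {n : ℕ} {f : OneParticle}
    (hfd : ∀ φ, resolvent φ ∈ (a f).domain)
    (hfn : MemLp (fun k => ((omega k ^ n : ℝ) : ℂ) * f k) 2 volume)
    {c : ℕ → ℂ} (hc : ∀ j, ‖c j‖ ≤ n.choose j)
    (hexp : ∀ g : ℕ → OneParticle,
      (∀ j ∈ Finset.Icc 1 n, ∀ᵐ x, g j x = ((omega x ^ j : ℝ) : ℂ) * f x) →
      ∀ (ψ φ y z : FockSpace) (χ : ℕ → FockSpace), (ψ, φ) ∈ (powOp Theta n).graph →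
        (ψ, y) ∈ (a f).graph → (φ, z) ∈ (a f).graph →
        (∀ j ∈ Finset.Icc 1 n, ((resolvent ^ j) φ, χ j) ∈ (a (g j)).graph) →
        (y, ∑ j ∈ Finset.Icc 1 n, c j • χ j + z) ∈ (powOp Theta n).graph) :
    OpNormLE (mulOp (commOp (powOp Theta n) (a f)) (powOp Theta n).inverse)
      (∑ k ∈ Finset.Icc 1 n, (n.choose k : ℝ) *
        normL2 fun x => ((omega x ^ k + 1 : ℝ) : ℂ) * f x) := by
  choose g B hgB using ha.exists_family hfn
  have hB := norm_sum_smul_mul_pow_le (s := Finset.Icc 1 n) norm_resolvent_le (fun j _ => hc j)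
    fun j hj => (hgB j hj).2.1
  refine opNormLE_commOp_mulOp_inverse (powOp_Theta_ker n) denseRange_resolvent hfd
    (fun φ => ⟨(resolvent ^ n) φ, ?_⟩) hB ?_
  · have h := resolvent_pow_mem_graph n (resolvent φ)
    rwa [resolvent_pow_resolvent, ← resolvent_resolvent_pow] at h
  · intro ψ φ y z hψ hy hz
    have h := hexp g (fun j hj => (hgB j hj).1) ψ φ y z
      (fun j => B j ((resolvent ^ (j - 1)) φ)) hψ hy hz (fun j hj => ?_)
    · rwa [sum_apply]
    · have h1 := (hgB j hj).2.2 ((resolvent ^ (j - 1)) φ)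
      have hj1 : j = j - 1 + 1 := (Nat.sub_add_cancel (Finset.mem_Icc.1 hj).1).symm
      rwa [resolvent_resolvent_pow, ← hj1] at h1

theorem isThetaBounded_annihilation : IsThetaBounded annihilation :=
  fun _ _ hG _ h2 => exists_annihilation_resolvent hG h2

theorem isThetaBounded_creation : IsThetaBounded creation :=
  fun _ _ hG h1 h2 => exists_creation_resolvent hG h1 h2

theorem IsThetaBounded.resolvent_mem_domain {a : OneParticle → FockSpace →ₗ.[ℂ] FockSpace}
    (ha : IsThetaBounded a) {f : OneParticle}
    (hf : MemLp (fun k => ((omega k ^ (-1 / 2 : ℝ) : ℝ) : ℂ) * f k) 2 volume) (φ : FockSpace) :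
    resolvent φ ∈ (a f).domain :=
  let ⟨χ, hχ, _⟩ := ha f _ (memLp_add_one_mul hf) (ae_norm_le_rpow_add_one_mul f)
    (ae_norm_le_sqrt_mul_rpow_add_one_mul f) φ
  LinearPMap.mem_domain_iff.2 ⟨χ, hχ⟩

end Fock

theorem lemma2p04 (n : ℕ) (f : Fock.OneParticle)
    (hf : MemLp (fun k => ((Fock.omega k ^ (-1 / 2 : ℝ) : ℝ) : ℂ) * f k) 2 volume)
    (hfn : MemLp (fun k => ((Fock.omega k ^ n : ℝ) : ℂ) * f k) 2 volume) :
    ∀ A ∈ ({Fock.annihilation f, Fock.creation f} :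
        Set (Fock.FockSpace →ₗ.[ℂ] Fock.FockSpace)),
      (Fock.mulOp A Fock.Theta.inverse).domain = ⊤ ∧
      Fock.OpNormLE (Fock.mulOp A Fock.Theta.inverse)
        (Fock.normL2 fun k => ((Fock.omega k ^ (-1 / 2 : ℝ) + 1 : ℝ) : ℂ) * f k) ∧
      Fock.OpNormLE
        (Fock.mulOp (Fock.commOp (Fock.powOp Fock.Theta n) A) (Fock.powOp Fock.Theta n).inverse)
        (∑ k ∈ Finset.Icc 1 n, (n.choose k : ℝ) *
          Fock.normL2 fun x => ((Fock.omega x ^ k + 1 : ℝ) : ℂ) * f x) := by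
  rintro A (rfl | rfl)
  · have ha := Fock.isThetaBounded_annihilation
    obtain ⟨hdom, hbdd⟩ := ha.mulOp_Theta_inverse hf
    exact ⟨hdom, hbdd, ha.commOp_powOp_Theta (ha.resolvent_mem_domain hf) hfn
      (c := fun j => (-1) ^ j * n.choose j) (fun j => by simp)
      fun g hg ψ φ y z χ h1 h2 h3 h4 => Fock.powOp_Theta_annihilation hg h1 h2 h3 h4⟩
  · have ha := Fock.isThetaBounded_creation
    obtain ⟨hdom, hbdd⟩ := ha.mulOp_Theta_inverse hf
    exact ⟨hdom, hbdd, ha.commOp_powOp_Theta (ha.resolvent_mem_domain hf) hfn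
      (c := fun j => n.choose j) (fun j => by simp)
      fun g hg ψ φ y z χ h1 h2 h3 h4 => Fock.powOp_Theta_creation hg h1 h2 h3 h4⟩
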